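/- Consider $K$ arms and a horizon $T$. Pulling arm $k\in\{1,\dots,K\}$ at epoch $t$ yields the reward $Y_{k,t}=\mu_{k,t}+\epsilon_t$, where the deterministic sequence $(\mu_{k,t})_t$ is real and periodic in $t$ with minimal period $T_k\ge 1$. Write $\mu_{k,t}=\sum_{j=0}^{T_k-1}b_{k,j}e^{2\pi i jt/T_k}$ and let $$B_k=\sup\{|b_{k,j}|:|b_{k,j}|>0,\ 0\le j<T_k\},\qquad b_k=\inf\{|b_{k,j}|:|b_{k,j}|>0,\ 0\le j<T_k\}$$ (with $B_k=0$, $b_k=+\infty$ if all $b_{k,j}$ vanish). Let $n,g$ be natural numbers, $H>0$, $\sigma>0$, $nK\le T$, and put $$A_j=\sup_{\nu\in[j,j+1]}\frac{|\sin(\pi\nu)|}{\pi\nu},\quad U_1=\sum_{j=0}^{\lfloor (n-2g-1)/(4g)\rfloor}A_{(2j+1)g},\quad U_2=\sum_{j=1}^{\lfloor (n-1)/(4g)\rfloor}A_{2jg-1},\quad \bar\epsilon=\frac{2\sigma H}{1-\pi/24}\sqrt{\frac{\log n}{n}}.$$ **Algorithm.** Arm $k$ is pulled at the $n$ epochs $n(k-1)+1,\dots,nk$.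 For each $k$, compute the periodogram $|\tilde y_k(v)|=\bigl|\frac1n\sum_{s=n(k-1)+1}^{nk}Y_{k,s}e^{-2\pi i vs}\bigr|$, $v\in[0,1/2]$, the threshold $\tau_k=\bar\epsilon+\frac{\pi U_1}{1-\pi U_2}\bigl(\bar\epsilon+\sup_{v\in[0,1/2]}|\tilde y_k(v)|\bigr)$, the candidate set $\mathcal F=\{j_1/j_2: j_1,j_2\in\mathbb N,\ 1\le j_1<j_2<\frac{n}{2g}\}$ and the domain $\mathcal D=\{v:\frac gn\le v\le\frac12,\ |\tilde y_k(v)|>\tau_k\}$. While $\mathcal D\ne\emptyset$, in the $i$-th pass take a maximizer $v_i^*$ of $|\tilde y_k|$ over $\mathcal D$ and an element $\hat v_i$ of $\mathcal F$ closest to $v_i^*$, and replace $\mathcal D$ by $\mathcal D\setminus(\hat v_i-\frac gn,\hat v_i+\frac gn)$. When $\mathcal D=\emptyset$, return $\hat T_k$, the least common multiple of $\hat v_1^{-1},\hat v_2^{-1},\dots$, that is, the least positive integer that is an integer multiple of every $\hat v_i^{-1}$ (so $\hat T_k=1$ if there are none). **Theorem.** Assume: 1. $\epsilon_1,\dots,\epsilon_T$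 are independent and sub-Gaussian with parameter $\sigma$: $\mathbb E[e^{\lambda\epsilon_t}]\le e^{\sigma^2\lambda^2/2}$ for all $\lambda\in\mathbb R$ (hence $\mathbb E[\epsilon_t]=0$ and $\mathbb P(|\epsilon_t|>x)\le 2e^{-x^2/(2\sigma^2)}$ for $x>0$); 2. $T>4K$, $g\ge\max\{2,\sqrt n\}$ and $T_k<\frac{n}{2g}$ for every $k$; 3. for every $k$, $$b_k\ \ge\ \Bigl(\frac{2\pi U_1}{1-\pi U_2}+2\Bigr)\bar\epsilon+\max\Bigl\{\frac{8\pi}{3}U_2,\ \frac{\pi U_1}{1-\pi U_2}\max\{\pi U_1,\pi U_2+1\}+\pi U_2\Bigr\}B_k .$$ Let $\Lambda$ be the event that, for every arm $k$, the algorithm terminates and returns $\hat T_k=T_k$, however ties in its choices are broken. Then $$\mathbb P(\Lambda)\ \ge\ 1-\frac{48K}{n^{H^2-1}}-\frac{200K}{n^{0.867H^2-1}}-\frac{200K}{n^{0.694H^2-1}} .$$ More precisely, $\Lambda$ contains a measurable event whose probability is at least the right-hand side. -/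

import Mathlib

open scoped NNReal
open MeasureTheory ProbabilityTheory

namespace PeriodicBandit

noncomputable section

/-! ### Mean rewards and their Fourier coefficients -/

/-- `p` is the (minimal) period of the sequence of mean rewards `m 1, m 2, …` of an arm. -/
def IsMinimalPeriod (m : ℕ → ℝ) (p : ℕ) : Prop :=
  IsLeast {q : ℕ | 0 < q ∧ Function.Periodic m q} p

/-- The coefficient `b_j` in the representation
`m t = ∑_{j=0}^{p-1} b_j exp (2 π i (j / p) t)` of a sequence `m` of period `p`
(the representation itself is `fourierCoeff_representation` below). -/
def fourierCoeff (m : ℕ → ℝ) (p j : ℕ) : ℂ :=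
  (1 / (p : ℂ)) * ∑ t ∈ Finset.range p,
    (m t : ℂ) * Complex.exp (-(2 * Real.pi * Complex.I * (j / p) * t))

theorem fourierCoeff_representation (m : ℕ → ℝ) (p : ℕ) (hp : 0 < p)
    (hm : Function.Periodic m p) (t : ℕ) :
    (m t : ℂ) = ∑ j ∈ Finset.range p,
      fourierCoeff m p j * Complex.exp (2 * Real.pi * Complex.I * (j / p) * t) := by
  have hpC : (p : ℂ) ≠ 0 := by exact_mod_cast hp.ne'
  have hgeo : ∀ s ∈ Finset.range p,
      ∑ j ∈ Finset.range p, Complex.exp (-(2 * Real.pi * Complex.I * (j / p) * s)) *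
        Complex.exp (2 * Real.pi * Complex.I * (j / p) * t) = if s = t % p then (p : ℂ) else 0 := by
    intro s hs
    set x := Complex.exp (2 * Real.pi * Complex.I * (((t : ℂ) - s) / p)) with hx
    have hterm : ∀ j : ℕ, Complex.exp (-(2 * Real.pi * Complex.I * (j / p) * s)) *
        Complex.exp (2 * Real.pi * Complex.I * (j / p) * t) = x ^ j := by
      intro j
      rw [← Complex.exp_add, hx, ← Complex.exp_nat_mul]
      congr 1
      ring
    have hxp : x ^ p = 1 := by
      rw [hx, ← Complex.exp_nat_mul, Complex.exp_eq_one_iff]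
      refine ⟨(t : ℤ) - s, ?_⟩
      push_cast
      field_simp
    have hx1 : x = 1 ↔ s = t % p := by
      rw [hx, Complex.exp_eq_one_iff]
      have hs' : s % p = s := Nat.mod_eq_of_lt (Finset.mem_range.mp hs)
      constructor
      · rintro ⟨c, hc⟩
        have h2 : (2 * Real.pi * Complex.I : ℂ) ≠ 0 := Complex.two_pi_I_ne_zero
        have h3 : ((t : ℂ) - s) / p = c := by
          apply mul_left_cancel₀ h2
          rw [hc]
          ring
        rw [div_eq_iff hpC] at h3
        have h4 : (t : ℤ) - s = c * p := by exact_mod_cast h3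
        have h5 : s ≡ t [MOD p] := (Nat.modEq_iff_dvd).mpr ⟨c, by rw [h4]; ring⟩
        rw [← hs']
        exact h5
      · intro h
        refine ⟨((t / p : ℕ) : ℤ), ?_⟩
        have h6 : (t : ℂ) = p * ((t / p : ℕ) : ℂ) + s := by
          rw [h]
          exact_mod_cast (Nat.div_add_mod t p).symm
        rw [h6, Int.cast_natCast]
        field_simp
        ring
    simp_rw [hterm]
    split_ifs with h
    · simp [hx1.mpr h]
    · have h7 : x ≠ 1 := fun h' => h (hx1.mp h')
      rw [geom_sum_eq h7, hxp]
      simp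
  have hswap : ∑ j ∈ Finset.range p,
      fourierCoeff m p j * Complex.exp (2 * Real.pi * Complex.I * (j / p) * t) =
      (1 / (p : ℂ)) * ∑ s ∈ Finset.range p, (m s : ℂ) *
        ∑ j ∈ Finset.range p, Complex.exp (-(2 * Real.pi * Complex.I * (j / p) * s)) *
          Complex.exp (2 * Real.pi * Complex.I * (j / p) * t) := by
    simp only [fourierCoeff, Finset.mul_sum, Finset.sum_mul]
    rw [Finset.sum_comm]
    refine Finset.sum_congr rfl fun s _ => Finset.sum_congr rfl fun j _ => ?_
    ring
  rw [hswap, Finset.sum_congr rfl fun s hs => by rw [hgeo s hs]]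
  have hmod : t % p ∈ Finset.range p := Finset.mem_range.mpr (Nat.mod_lt t hp)
  simp only [mul_ite, mul_zero, Finset.sum_ite_eq', hmod, if_true]
  rw [hm.map_mod_nat t]
  field_simp

/-- The set of magnitudes `|b_j| > 0` of the present frequencies `j / p`, `0 ≤ j < p`. -/
def presentMagnitudes (m : ℕ → ℝ) (p : ℕ) : Set ℝ :=
  {a | 0 < a ∧ ∃ j < p, a = ‖fourierCoeff m p j‖}

/-- `B`: the magnitude of the strongest present frequency
(it is `0` if no frequency is present, that is, if `m` is identically zero). -/
def maxMagnitude (m : ℕ → ℝ) (p : ℕ) : ℝ := sSup (presentMagnitudes m p)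

/-- `b`: the magnitude of the weakest present frequency, with the usual convention
`inf ∅ = +∞` if no frequency is present, that is, if `m` is identically zero. -/
def minMagnitude (m : ℕ → ℝ) (p : ℕ) : EReal :=
  sInf ((fun a : ℝ => (a : EReal)) '' presentMagnitudes m p)

/-! ### The quantities computed by the algorithm

Arms are numbered `0, …, K - 1`; arm `k` is pulled at the `n` consecutive epochs
`n k + 1, …, n (k + 1)`. In what follows `y t` is the reward of arm `k` at epoch `t`. -/

/-- The periodogram `|(1/n) ∑_{s = n k + 1}^{n (k + 1)} y_s exp (-2 π i v s)|`. -/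
def periodogram (n k : ℕ) (y : ℕ → ℝ) (v : ℝ) : ℝ :=
  ‖(1 / (n : ℂ)) * ∑ s ∈ Finset.Icc (n * k + 1) (n * (k + 1)),
    (y s : ℂ) * Complex.exp (-(2 * Real.pi * Complex.I * v * s))‖

/-- The candidate frequencies `j₁ / j₂` with `1 ≤ j₁ < j₂ < n / (2 g)`. -/
def candidateFrequencies (n g : ℕ) : Set ℚ :=
  {q | ∃ j₁ j₂ : ℕ, 1 ≤ j₁ ∧ j₁ < j₂ ∧ (j₂ : ℝ) < (n : ℝ) / (2 * g) ∧ q = (j₁ : ℚ) / (j₂ : ℚ)}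

/-- `A_j = sup {|sin (π ν)| / (π ν) : ν ∈ [j, j + 1]}` (used for `j ≥ 1` only). -/
def lobeSup (j : ℕ) : ℝ :=
  sSup ((fun ν : ℝ => |Real.sin (Real.pi * ν)| / (Real.pi * ν)) '' Set.Icc (j : ℝ) (j + 1))

/-- `U₁ = ∑_{j=0}^{⌊(n - 2g - 1) / (4g)⌋} A_{(2j+1)g}`. The natural-number operations are exact
here since `n ≥ 2g + 1` whenever some arm has a period `< n / (2g)`. -/
def leakageOne (n g : ℕ) : ℝ :=
  ∑ j ∈ Finset.range ((n - 2 * g - 1) / (4 * g) + 1), lobeSup ((2 * j + 1) * g)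

/-- `U₂ = ∑_{j=1}^{⌊(n - 1) / (4g)⌋} A_{2jg-1}`. -/
def leakageTwo (n g : ℕ) : ℝ :=
  ∑ j ∈ Finset.Icc 1 ((n - 1) / (4 * g)), lobeSup (2 * j * g - 1)

/-- `ε̄ = (2 σ H / (1 - π / 24)) √(log n / n)`. -/
def noiseLevel (n : ℕ) (σ H : ℝ) : ℝ :=
  2 * σ * H / (1 - Real.pi / 24) * Real.sqrt (Real.log n / n)

/-- The threshold `ε̄ + (π U₁ / (1 - π U₂)) (ε̄ + sup_{v ∈ [0, 1/2]} Y(v))` for a periodogram `Y`. -/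
def threshold (n g : ℕ) (σ H : ℝ) (Y : ℝ → ℝ) : ℝ :=
  noiseLevel n σ H + Real.pi * leakageOne n g / (1 - Real.pi * leakageTwo n g) *
    (noiseLevel n σ H + sSup (Y '' Set.Icc (0 : ℝ) (1 / 2)))

/-- The initial frequency domain `{v : g / n ≤ v ≤ 1 / 2, Y(v) > threshold}`. -/
def initialDomain (n g : ℕ) (σ H : ℝ) (Y : ℝ → ℝ) : Set ℝ :=
  {v | (g : ℝ) / n ≤ v ∧ v ≤ 1 / 2 ∧ threshold n g σ H Y < Y v}

/-! ### The search loop -/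

/-- The state of the search: the current frequency domain and the frequencies found so far. -/
structure SearchState where
  domain : Set ℝ
  found : List ℚ

/-- One pass through the loop: some global maximiser `w` of the periodogram `Y` over the
current domain is chosen, some candidate frequency `q` closest to `w` is recorded, and the open
interval of radius `g / n` around `q` is removed. The relation allows every way of breaking ties. -/
def SearchStep (n g : ℕ) (Y : ℝ → ℝ) (s s' : SearchState) : Prop :=
  ∃ w ∈ s.domain, IsMaxOn Y s.domain w ∧
    ∃ q ∈ candidateFrequencies n g,
      IsMinOn (fun r : ℚ => |(r : ℝ) - w|) (candidateFrequencies n g) q ∧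
      s'.domain = s.domain \ Set.Ioo ((q : ℝ) - (g : ℝ) / n) ((q : ℝ) + (g : ℝ) / n) ∧
      s'.found = q :: s.found

/-- The least common multiple of the reciprocals of the frequencies in a list: the least positive
integer that is an integer multiple of `q⁻¹` for all `q` in the list (`1` for the empty list). -/
def lcmReciprocals (l : List ℚ) : ℕ :=
  sInf {m : ℕ | 0 < m ∧ ∀ q ∈ l, ∃ c : ℕ, (m : ℚ) = c * q⁻¹}

/-- From state `s` the search loop terminates and returns `m`, however ties are broken:
if the domain is empty it halts with the least common multiple, otherwise a pass through the
loop is possible and every possible pass leads to a state with this property. -/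
inductive AlwaysReturns (n g : ℕ) (Y : ℝ → ℝ) : SearchState → ℕ → Prop
  | halt (s : SearchState) (h : s.domain = ∅) : AlwaysReturns n g Y s (lcmReciprocals s.found)
  | step (s : SearchState) (m : ℕ) (hne : s.domain.Nonempty)
      (hex : ∃ s', SearchStep n g Y s s')
      (hall : ∀ s', SearchStep n g Y s s' → AlwaysReturns n g Y s' m) : AlwaysReturns n g Y s m

/-- On the rewards `y` of arm `k` the algorithm terminates and estimates the period of this arm
as `m`, however ties are broken. -/
def EstimatesPeriod (n g : ℕ) (σ H : ℝ) (k : ℕ) (y : ℕ → ℝ) (m : ℕ) : Prop :=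
  AlwaysReturns n g (periodogram n k y)
    ⟨initialDomain n g σ H (periodogram n k y), []⟩ m

/-! ### The bandit model and the assumptions -/

/-- The reward `Y_{k,t} = μ_{k,t} + ε_t`. -/
def reward {Ω : Type*} {K : ℕ} (μ : Fin K → ℕ → ℝ) (ε : ℕ → Ω → ℝ) (ω : Ω) (k : Fin K) (t : ℕ) :
    ℝ :=
  μ k t + ε t ω

/-- The noise variables `ε_1, …, ε_T` are independent and sub-Gaussian with parameter `σ`:
`E[exp (x ε_t)] ≤ exp (σ² x² / 2)` for all real `x`. That they are centred and satisfy
`P(|ε_t| > x) ≤ 2 exp (-x² / (2 σ²))` follows from this. -/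
structure SubGaussianNoise {Ω : Type*} [MeasurableSpace Ω] (P : Measure Ω) (T : ℕ) (σ : ℝ≥0)
    (ε : ℕ → Ω → ℝ) : Prop where
  measurable : ∀ t ∈ Finset.Icc 1 T, Measurable (ε t)
  indep : iIndepFun (fun t : Finset.Icc 1 T => ε t) P
  subGaussian : ∀ t ∈ Finset.Icc 1 T, HasSubgaussianMGF (ε t) (σ ^ 2) P

/-- The condition on the horizon, the neighbourhood parameter `g` and the periods `p k`. -/
structure PeriodCondition (K T n g : ℕ) (p : Fin K → ℕ) : Prop where
  horizon : 4 * K < T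
  two_le : 2 ≤ g
  sqrt_le : Real.sqrt n ≤ g
  period_lt : ∀ k, (p k : ℝ) < (n : ℝ) / (2 * g)

/-- The condition that the weakest present frequency of an arm is not too weak in comparison with
the noise level and with the strongest present frequency. -/
def MagnitudeCondition (n g : ℕ) (σ H : ℝ) (m : ℕ → ℝ) (p : ℕ) : Prop :=
  (((2 * Real.pi * leakageOne n g / (1 - Real.pi * leakageTwo n g) + 2) * noiseLevel n σ H +
      max (8 * Real.pi / 3 * leakageTwo n g)
        (Real.pi * leakageOne n g / (1 - Real.pi * leakageTwo n g) *
            max (Real.pi * leakageOne n g) (Real.pi * leakageTwo n g + 1) +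
          Real.pi * leakageTwo n g) * maxMagnitude m p : ℝ) : EReal) ≤ minMagnitude m p

/-- The event that, for every arm, the algorithm estimates the period correctly. -/
def correctEvent {Ω : Type*} {K : ℕ} (n g : ℕ) (σ H : ℝ) (μ : Fin K → ℕ → ℝ) (ε : ℕ → Ω → ℝ)
    (p : Fin K → ℕ) : Set Ω :=
  {ω | ∀ k : Fin K, EstimatesPeriod n g σ H k (reward μ ε ω k) (p k)}

end

end PeriodicBandit

/-! The transform of the means of an arm of period `p` is the sum of the coefficients `b_j`, each
times a kernel of modulus `dirichlet n (j / p - v)`. As `2 * g * p < n`, the frequencies `j / p` are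
more than `2 g / n` apart. So at each `v` at most one of them is close, and the others leak at most
`B` times a sum of kernel values. This sum is at most `π U₂` within `1 / n` of a frequency
(`leakage_le_two`), and at most `π U₁` when `v` is at least `g / n` away from all of them
(`sum_range_dirichlet_le_far`).

Let the transform of the noise be below `3/4 ε̄` at every frequency (`GoodArm`). Outside the `g /
n`-neighbourhoods of the present frequencies the signal is at most `π U₁ B`, while the threshold is
at least `ε̄ + π U₁ B` (`le_threshold`). Hence these neighbourhoods cover the domain. The lower
bound on the weakest coefficient puts every present frequency of `(0, 1/2]` into the domain. A
maximiser over what is left of the domain is within `2 / n` of a present frequency `j / p`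
(`close_of_periodogram_le`), so the closest candidate is within `4 / n` of `j / p`. Fractions with
denominators below `n / (2g)` that differ are more than `4 / n` apart, because `n ≤ g²`; so the
candidate is exactly `j / p`. Each pass therefore finds one new present frequency, and the loop ends
when all are found. An integer that is a multiple of every `p / j` found is a period of the means,
so the least one is `p`.

For the noise, a union bound runs over the arms, `50 n` grid frequencies and four real directions.
Passing from the grid to all frequencies is a statement about polynomials of degree below `n` on the
unit circle (`norm_sq_polynomial_le`). -/

namespace PeriodicBandit

noncomputable section

/-! ### The Dirichlet kernel -/

/-- The modulus of the normalised Dirichlet kernel `(1/n) ∑_{i < n} exp (2 π i x i)`. -/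
def dirichlet (n : ℕ) (x : ℝ) : ℝ :=
  ‖(1 / (n : ℂ)) * ∑ i ∈ Finset.range n, Complex.exp (2 * Real.pi * Complex.I * x * i)‖

theorem dirichlet_nonneg (n : ℕ) (x : ℝ) : 0 ≤ dirichlet n x := norm_nonneg _

theorem norm_exp_two_pi_mul (x y : ℝ) :
    ‖Complex.exp (2 * Real.pi * Complex.I * x * y)‖ = 1 := by
  rw [show (2 * Real.pi * Complex.I * x * y : ℂ) = ((2 * Real.pi * x * y : ℝ) : ℂ) * Complex.I by
    push_cast; ring]
  exact Complex.norm_exp_ofReal_mul_I _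

theorem norm_exp_two_pi_mul_nat (x : ℝ) (y : ℕ) :
    ‖Complex.exp (2 * Real.pi * Complex.I * x * y)‖ = 1 := by
  exact_mod_cast norm_exp_two_pi_mul x y

theorem dirichlet_le_one (n : ℕ) (x : ℝ) : dirichlet n x ≤ 1 := by
  rcases Nat.eq_zero_or_pos n with rfl | hn
  · simp [dirichlet]
  have hn' : (0 : ℝ) < n := by exact_mod_cast hn
  unfold dirichlet
  rw [norm_mul]
  have h1 : ‖∑ i ∈ Finset.range n, Complex.exp (2 * Real.pi * Complex.I * x * i)‖ ≤ n := by
    refine (norm_sum_le _ _).trans ?_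
    simp [norm_exp_two_pi_mul_nat]
  have h2 : ‖(1 / (n : ℂ))‖ = 1 / n := by simp
  rw [h2]
  calc _ ≤ 1 / (n : ℝ) * n := by gcongr
    _ = 1 := by field_simp

theorem dirichlet_add_one (n : ℕ) (x : ℝ) : dirichlet n (x + 1) = dirichlet n x := by
  unfold dirichlet
  congr 2
  refine Finset.sum_congr rfl fun i _ => ?_
  rw [Complex.exp_eq_exp_iff_exists_int]
  exact ⟨i, by push_cast; ring⟩

theorem dirichlet_neg (n : ℕ) (x : ℝ) : dirichlet n (-x) = dirichlet n x := by
  unfold dirichlet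
  rw [← Complex.norm_conj]
  congr 1
  simp only [map_mul, map_div₀, map_one, Complex.conj_natCast, map_sum, ← Complex.exp_conj,
    Complex.conj_I, Complex.conj_ofReal, map_ofNat]
  congr 1
  refine Finset.sum_congr rfl fun i _ => ?_
  congr 1
  push_cast
  ring

theorem norm_exp_two_pi_sub_one (x : ℝ) :
    ‖Complex.exp (2 * Real.pi * Complex.I * x) - 1‖ = 2 * |Real.sin (Real.pi * x)| := by
  rw [show (2 * Real.pi * Complex.I * x : ℂ) = Complex.I * ((2 * Real.pi * x : ℝ) : ℂ) by
    push_cast; ring, Complex.norm_exp_I_mul_ofReal_sub_one, norm_mul, Real.norm_eq_abs,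
    Real.norm_eq_abs, abs_of_pos (by norm_num : (0 : ℝ) < 2)]
  congr 3
  ring

/-- The geometric sum in product form, which stays valid at integers `x`, where the sine vanishes.
-/
theorem dirichlet_mul_sin {n : ℕ} (hn : 0 < n) (x : ℝ) :
    dirichlet n x * (n * |Real.sin (Real.pi * x)|) = |Real.sin (Real.pi * (n * x))| := by
  have hn' : (0 : ℝ) < n := by exact_mod_cast hn
  set z := Complex.exp (2 * Real.pi * Complex.I * x) with hz
  have hterm : ∀ i : ℕ, Complex.exp (2 * Real.pi * Complex.I * x * i) = z ^ i := by
    intro i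
    rw [hz, ← Complex.exp_nat_mul]
    congr 1; ring
  have hgeo : (∑ i ∈ Finset.range n, z ^ i) * (z - 1) = z ^ n - 1 := geom_sum_mul z n
  have hnorm := congrArg norm hgeo
  rw [norm_mul, norm_exp_two_pi_sub_one, ← hterm n,
    show (2 * Real.pi * Complex.I * x * n : ℂ) = 2 * Real.pi * Complex.I * ((n * x : ℝ) : ℂ) by
      push_cast; ring, norm_exp_two_pi_sub_one] at hnorm
  have h2 : dirichlet n x = 1 / n * ‖∑ i ∈ Finset.range n, z ^ i‖ := by
    unfold dirichlet
    simp_rw [hterm]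
    rw [norm_mul]
    simp
  rw [h2]
  rw [show 1 / (n : ℝ) * ‖∑ i ∈ Finset.range n, z ^ i‖ * (n * |Real.sin (Real.pi * x)|) =
    ‖∑ i ∈ Finset.range n, z ^ i‖ * |Real.sin (Real.pi * x)| by field_simp]
  linarith

theorem two_mul_le_sin_pi_mul {d : ℝ} (h0 : 0 ≤ d) (h1 : d ≤ 1 / 2) :
    2 * d ≤ Real.sin (Real.pi * d) := by
  have h := Real.mul_le_sin (x := Real.pi * d) (by positivity) (by nlinarith [Real.pi_pos])
  calc 2 * d = 2 / Real.pi * (Real.pi * d) := by field_simp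
    _ ≤ _ := h

/-- The chord of the concave sine from `0` to `π / 4` has slope `2√2 ≥ 8/3` in `d`. The gain over
the slope `2` is what matches the constant `8π/3` of the magnitude condition. -/
theorem eight_thirds_mul_le_sin_pi_mul {d : ℝ} (h0 : 0 ≤ d) (h1 : d ≤ 1 / 4) :
    8 / 3 * d ≤ Real.sin (Real.pi * d) := by
  have hx : (0 : ℝ) ∈ Set.Icc 0 Real.pi := ⟨le_rfl, Real.pi_pos.le⟩
  have hy : Real.pi / 4 ∈ Set.Icc 0 Real.pi := ⟨by positivity, by linarith [Real.pi_pos]⟩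
  have ha : (0 : ℝ) ≤ 1 - 4 * d := by linarith
  have hb : (0 : ℝ) ≤ 4 * d := by linarith
  have hc := strictConcaveOn_sin_Icc.concaveOn.2 hx hy ha hb (by ring)
  simp only [smul_eq_mul, mul_zero, zero_add, Real.sin_zero, Real.sin_pi_div_four] at hc
  rw [show 4 * d * (Real.pi / 4) = Real.pi * d by ring] at hc
  have h2 : (4 / 3 : ℝ) ≤ √2 := Real.le_sqrt_of_sq_le (by norm_num)
  nlinarith

theorem dirichlet_le_of_sin_ge {n : ℕ} (hn : 0 < n) {d a : ℝ} (h0 : 0 < d) (ha : 0 < a)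
    (h : a * d ≤ Real.sin (Real.pi * d)) :
    dirichlet n d ≤ |Real.sin (Real.pi * (n * d))| / (a * (n * d)) := by
  have hn' : (0 : ℝ) < n := by exact_mod_cast hn
  rw [le_div_iff₀ (by positivity), ← dirichlet_mul_sin hn]
  refine mul_le_mul_of_nonneg_left ?_ (dirichlet_nonneg _ _)
  have := le_abs_self (Real.sin (Real.pi * d))
  nlinarith

theorem dirichlet_le_inv {n : ℕ} (hn : 0 < n) {d : ℝ} (h0 : 0 < d) (h1 : d ≤ 1 / 2) :
    dirichlet n d ≤ 1 / (2 * (n * d)) := by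
  have hn' : (0 : ℝ) < n := by exact_mod_cast hn
  refine (dirichlet_le_of_sin_ge hn h0 two_pos (two_mul_le_sin_pi_mul h0.le h1)).trans ?_
  gcongr
  exact Real.abs_sin_le_one _

theorem dirichlet_le_three_eighths {n : ℕ} (hn : 0 < n) {d : ℝ} (h0 : 0 < d) (h1 : d ≤ 1 / 4) :
    dirichlet n d ≤ 3 / (8 * (n * d)) := by
  have hn' : (0 : ℝ) < n := by exact_mod_cast hn
  refine (dirichlet_le_of_sin_ge hn h0 (by norm_num)
    (eight_thirds_mul_le_sin_pi_mul h0.le h1)).trans ?_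
  rw [show (3 : ℝ) / (8 * (n * d)) = 1 / (8 / 3 * (n * d)) by field_simp]
  gcongr
  exact Real.abs_sin_le_one _

/-! ### Suprema over the side lobes -/

theorem lobe_le_inv {j : ℕ} (hj : 1 ≤ j) {t : ℝ} (ht : (j : ℝ) ≤ t) :
    |Real.sin (Real.pi * t)| / (Real.pi * t) ≤ 1 / (Real.pi * j) := by
  have hj' : (1 : ℝ) ≤ j := by exact_mod_cast hj
  have := Real.pi_pos
  gcongr
  exact Real.abs_sin_le_one _

theorem bddAbove_lobe {j : ℕ} (hj : 1 ≤ j) :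
    BddAbove ((fun ν : ℝ => |Real.sin (Real.pi * ν)| / (Real.pi * ν)) ''
      Set.Icc (j : ℝ) (j + 1)) := by
  refine ⟨1 / (Real.pi * j), ?_⟩
  rintro _ ⟨t, ht, rfl⟩
  exact lobe_le_inv hj ht.1

theorem lobeSup_le {j : ℕ} (hj : 1 ≤ j) : lobeSup j ≤ 1 / (Real.pi * j) := by
  refine csSup_le ?_ ?_
  · exact ⟨_, j, ⟨le_rfl, by linarith⟩, rfl⟩
  · rintro _ ⟨t, ht, rfl⟩
    exact lobe_le_inv hj ht.1

theorem abs_sin_pi_mul_sub_nat (t : ℝ) (m : ℕ) :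
    |Real.sin (Real.pi * (t - m))| = |Real.sin (Real.pi * t)| := by
  rw [mul_sub, mul_comm Real.pi (m : ℝ), Real.sin_sub_nat_mul_pi, abs_mul, abs_pow]
  simp

/-- No upper bound on `t` is needed: `|sin (π t)|` has period 1 and the denominator grows, so
shifting `t` down by an integer into `[j, j + 1]` only increases the quotient. -/
theorem le_lobeSup {j : ℕ} (hj : 1 ≤ j) {t : ℝ} (ht : (j : ℝ) ≤ t) :
    |Real.sin (Real.pi * t)| / (Real.pi * t) ≤ lobeSup j := by
  have hj' : (1 : ℝ) ≤ j := by exact_mod_cast hj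
  set m := ⌊t - j⌋₊ with hm
  have h1 : (m : ℝ) ≤ t - j := Nat.floor_le (by linarith)
  have h2 : t - j < m + 1 := Nat.lt_floor_add_one _
  have h3 := le_csSup (bddAbove_lobe hj) ⟨t - m, ⟨by linarith, by linarith⟩, rfl⟩
  refine le_trans ?_ h3
  dsimp only
  rw [abs_sin_pi_mul_sub_nat]
  have h4 : (0 : ℝ) ≤ m := Nat.cast_nonneg m
  have h5 : 0 < t - m := by linarith
  have := Real.pi_pos
  gcongr
  linarith

/-- The sine has modulus 1 at the midpoint of the lobe. These lower bounds let explicit sums of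
reciprocals be absorbed into `U₁` and `U₂`. -/
theorem le_lobeSup_mid {j : ℕ} (hj : 1 ≤ j) : 1 / (Real.pi * (j + 1 / 2)) ≤ lobeSup j := by
  refine le_trans (le_of_eq ?_) (le_lobeSup hj (t := j + 1 / 2) (by linarith))
  rw [show Real.pi * ((j : ℝ) + 1 / 2) = Real.pi / 2 + j * Real.pi by ring,
    Real.sin_add_nat_mul_pi]
  simp [abs_pow]

theorem lobeSup_nonneg {j : ℕ} (hj : 1 ≤ j) : 0 ≤ lobeSup j :=
  le_trans (by positivity) (le_lobeSup_mid hj)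

theorem dirichlet_le_lobeSup {n j : ℕ} (hn : 0 < n) (hj : 1 ≤ j) {d : ℝ} (h1 : d ≤ 1 / 2)
    (hd : (j : ℝ) ≤ n * d) : dirichlet n d ≤ Real.pi / 2 * lobeSup j := by
  have hn' : (0 : ℝ) < n := by exact_mod_cast hn
  have hj' : (1 : ℝ) ≤ j := by exact_mod_cast hj
  have h0 : 0 < d := by
    by_contra h
    nlinarith
  refine (dirichlet_le_of_sin_ge hn h0 two_pos (two_mul_le_sin_pi_mul h0.le h1)).trans ?_
  have := mul_le_mul_of_nonneg_left (le_lobeSup hj hd) (by positivity : 0 ≤ Real.pi / 2)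
  refine le_trans (le_of_eq ?_) this
  have := Real.pi_pos
  field_simp

/-! ### Sums of the Dirichlet kernel over the frequencies `i / p` -/

theorem sum_range_add_of_periodic {M : Type*} [AddCommGroup M] {F : ℕ → M} {p : ℕ}
    (hF : ∀ i, F (i + p) = F i) (c : ℕ) :
    ∑ i ∈ Finset.range p, F (c + i) = ∑ i ∈ Finset.range p, F i := by
  induction c with
  | zero => simp
  | succ c ih =>
    rw [← ih]
    have h1 := Finset.sum_range_succ (fun i => F (c + i)) p
    have h2 := Finset.sum_range_succ' (fun i => F (c + i)) p
    have h3 : ∑ i ∈ Finset.range p, F (c + 1 + i) = ∑ i ∈ Finset.range p, F (c + (i + 1)) :=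
      Finset.sum_congr rfl fun i _ => by congr 1; ring
    rw [h3]
    rw [h1, hF] at h2
    simpa using h2.symm

theorem sum_erase_of_periodic {M : Type*} [AddCommGroup M] {F : ℕ → M} {p c : ℕ}
    (hF : ∀ i, F (i + p) = F i) (hc : c < p) :
    ∑ j ∈ (Finset.range p).erase c, F j = ∑ i ∈ Finset.Ico 1 p, F (c + i) := by
  have h1 := Finset.add_sum_erase (Finset.range p) F (Finset.mem_range.mpr hc)
  have h2 := sum_range_add_of_periodic hF c
  rw [Finset.range_eq_Ico, Finset.sum_eq_sum_Ico_succ_bot (by omega), ← Finset.range_eq_Ico,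
    ← h1] at h2
  simpa using h2.symm

theorem dirichlet_one_sub (n : ℕ) (x : ℝ) : dirichlet n (1 - x) = dirichlet n x := by
  rw [show 1 - x = -x + 1 by ring, dirichlet_add_one, dirichlet_neg]

theorem dirichlet_sub_div_sub (n : ℕ) {p i : ℕ} (hp : 0 < p) (hi : i ≤ p) (δ : ℝ) :
    dirichlet n (((p - i : ℕ) : ℝ) / p - δ) = dirichlet n (i / p + δ) := by
  have hp' : (0 : ℝ) < p := by exact_mod_cast hp
  rw [← dirichlet_one_sub]
  congr 1
  push_cast [hi]
  field_simp
  ring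

theorem sum_Ico_dirichlet_add (n p : ℕ) (δ : ℝ) :
    ∑ i ∈ Finset.Ico 1 p, dirichlet n ((i : ℝ) / p + δ) =
      ∑ i ∈ Finset.Ico 1 p, dirichlet n ((i : ℝ) / p - δ) := by
  refine Finset.sum_nbij' (fun i => p - i) (fun i => p - i) ?_ ?_ ?_ ?_ ?_
  · intro i hi; simp only [Finset.mem_Ico] at hi ⊢; omega
  · intro i hi; simp only [Finset.mem_Ico] at hi ⊢; omega
  · intro i hi; simp only [Finset.mem_Ico] at hi; omega
  · intro i hi; simp only [Finset.mem_Ico] at hi; omega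
  · intro i hi
    simp only [Finset.mem_Ico] at hi
    exact (dirichlet_sub_div_sub n (by omega) (by omega) δ).symm

theorem sum_Ico_dirichlet_abs (n p : ℕ) (δ : ℝ) :
    ∑ i ∈ Finset.Ico 1 p, dirichlet n ((i : ℝ) / p - δ) =
      ∑ i ∈ Finset.Ico 1 p, dirichlet n ((i : ℝ) / p - |δ|) := by
  rcases abs_cases δ with ⟨h, _⟩ | ⟨h, _⟩
  · rw [h]
  · rw [h, ← sum_Ico_dirichlet_add]
    simp [sub_eq_add_neg]

/-- The kernel is even with period 1, so the sign of `δ` is irrelevant and the term `i = 0` may be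
traded for `i = p`. The nearest frequency then lies to the left of the point and the two sides can
be treated separately. -/
theorem sum_range_dirichlet_abs {p : ℕ} (n : ℕ) (hp : 0 < p) (δ : ℝ) :
    ∑ i ∈ Finset.range p, dirichlet n ((i : ℝ) / p - δ) =
      ∑ i ∈ Finset.Ico 1 (p + 1), dirichlet n ((i : ℝ) / p - |δ|) := by
  have hp' : (p : ℝ) ≠ 0 := by exact_mod_cast hp.ne'
  rw [Finset.range_eq_Ico, Finset.sum_eq_sum_Ico_succ_bot hp, Finset.sum_Ico_succ_top hp,
    zero_add, sum_Ico_dirichlet_abs, add_comm]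
  congr 1
  rw [div_self hp', dirichlet_one_sub, Nat.cast_zero, zero_div, zero_sub, dirichlet_neg]
  rcases abs_cases δ with ⟨h, _⟩ | ⟨h, _⟩
  · rw [h]
  · rw [h, dirichlet_neg]

/-- The leakage from the other frequencies at distance at most `g / n` from a frequency. -/
theorem sum_Ico_dirichlet_le_near {n g p : ℕ} (hg : 0 < g) (hp : 0 < p) (hn : 2 * g * p < n)
    {δ : ℝ} (hδ : n * |δ| ≤ g) :
    ∑ i ∈ Finset.Ico 1 p, dirichlet n ((i : ℝ) / p - δ) ≤
      ∑ i ∈ Finset.Icc 1 (p / 2),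
        (1 / (2 * (2 * i * g - n * |δ|)) + 1 / (2 * (2 * i * g + n * |δ|))) := by
  rw [sum_Ico_dirichlet_abs]
  set x := |δ| with hx
  have hx0 : 0 ≤ x := abs_nonneg δ
  have hp' : (0 : ℝ) < p := by exact_mod_cast hp
  have hg' : (0 : ℝ) < g := by exact_mod_cast hg
  have hnR : (2 * g * p : ℝ) < n := by exact_mod_cast hn
  have hn' : (0 : ℝ) < n := lt_trans (by positivity) hnR
  have hn0 : 0 < n := by exact_mod_cast hn'
  have hnp : (2 * g : ℝ) ≤ n / p := by rw [le_div_iff₀ hp']; exact hnR.le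
  have hnx0 : 0 ≤ n * x := by positivity
  rw [Finset.sum_add_distrib, ← Finset.Ico_add_one_right_eq_Icc,
    ← Finset.sum_Ico_consecutive _ (show 1 ≤ p / 2 + 1 by omega) (show p / 2 + 1 ≤ p by omega)]
  refine add_le_add ?_ ?_
  · refine Finset.sum_le_sum fun i hi => ?_
    simp only [Finset.mem_Ico] at hi
    have hi1 : (1 : ℝ) ≤ i := by exact_mod_cast hi.1
    have hi2 : (2 * i : ℝ) ≤ p := by exact_mod_cast (show 2 * i ≤ p by omega)
    have hd : 2 * i * g - n * x ≤ n * ((i : ℝ) / p - x) := by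
      have : 2 * g * (i : ℝ) ≤ n / p * i := by gcongr
      calc 2 * i * g - n * x ≤ n / p * i - n * x := by linarith
        _ = _ := by ring
    have hpos : 0 < 2 * i * g - n * x := by nlinarith
    have hd0 : 0 < (i : ℝ) / p - x := by
      by_contra h
      nlinarith
    have hd1 : (i : ℝ) / p - x ≤ 1 / 2 := by
      have : (i : ℝ) / p ≤ 1 / 2 := by rw [div_le_iff₀ hp']; linarith
      linarith
    refine (dirichlet_le_inv hn0 hd0 hd1).trans ?_
    gcongr
  -- The frequencies on the other side, reflected by `i ↦ p - i`. There are at most `p / 2` of them,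
  -- and the missing terms of the bound are nonnegative.
  · have hsub : Finset.Ico 1 (p - p / 2) ⊆ Finset.Ico 1 (p / 2 + 1) := by
      apply Finset.Ico_subset_Ico_right; omega
    refine le_trans ?_ (Finset.sum_le_sum_of_subset_of_nonneg hsub fun i _ _ => by positivity)
    have hre : ∑ i ∈ Finset.Ico (p / 2 + 1) p, dirichlet n ((i : ℝ) / p - x) =
        ∑ i ∈ Finset.Ico 1 (p - p / 2), dirichlet n ((i : ℝ) / p + x) := by
      refine Finset.sum_nbij' (fun i => p - i) (fun i => p - i) ?_ ?_ ?_ ?_ ?_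
      · intro i hi; simp only [Finset.mem_Ico] at hi ⊢; omega
      · intro i hi; simp only [Finset.mem_Ico] at hi ⊢; omega
      · intro i hi; simp only [Finset.mem_Ico] at hi; omega
      · intro i hi; simp only [Finset.mem_Ico] at hi; omega
      · intro i hi
        simp only [Finset.mem_Ico] at hi
        rw [← dirichlet_sub_div_sub n hp (by omega), Nat.sub_sub_self (by omega)]
    rw [hre]
    refine Finset.sum_le_sum fun i hi => ?_
    simp only [Finset.mem_Ico] at hi
    have hi1 : (1 : ℝ) ≤ i := by exact_mod_cast hi.1
    have hi2 : (2 * i + 1 : ℝ) ≤ p := by exact_mod_cast (show 2 * i + 1 ≤ p by omega)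
    have hd : 2 * i * g + n * x ≤ n * ((i : ℝ) / p + x) := by
      have : 2 * g * (i : ℝ) ≤ n / p * i := by gcongr
      calc 2 * i * g + n * x ≤ n / p * i + n * x := by linarith
        _ = _ := by ring
    have hd1 : (i : ℝ) / p + x ≤ 1 / 2 := by
      have h1 : p * x ≤ 1 / 2 := by
        have h3 : p * (n * x) ≤ p * g := by gcongr
        by_contra h
        nlinarith
      have : (i : ℝ) / p + x = (i + p * x) / p := by field_simp
      rw [this, div_le_iff₀ hp']
      linarith
    refine (dirichlet_le_inv hn0 (by positivity) hd1).trans ?_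
    have hpos : 0 < 2 * i * g + n * x := by positivity
    gcongr

theorem mem_range_leakageOne {n g r p : ℕ} (hg : 0 < g) (hn : 2 * g * p < n) (hr : 2 * r + 1 ≤ p) :
    r < (n - 2 * g - 1) / (4 * g) + 1 := by
  have h : r ≤ (n - 2 * g - 1) / (4 * g) := by
    rw [Nat.le_div_iff_mul_le (by omega)]
    have : 2 * g * (2 * r + 1) ≤ 2 * g * p := by gcongr
    have h2 : r * (4 * g) + 2 * g = 2 * g * (2 * r + 1) := by ring
    omega
  omega

/-- The leakage at distance at least `g / n` from all frequencies. -/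
theorem sum_range_dirichlet_le_far {n g p : ℕ} (hg : 0 < g) (hp : 0 < p) (hn : 2 * g * p < n)
    {δ : ℝ} (hδ : g ≤ n * |δ|) (hδ' : p * |δ| ≤ 1 / 2) :
    ∑ i ∈ Finset.range p, dirichlet n ((i : ℝ) / p - δ) ≤ Real.pi * leakageOne n g := by
  rw [sum_range_dirichlet_abs n hp]
  set x := |δ| with hx
  have hx0 : 0 ≤ x := abs_nonneg δ
  have hp' : (0 : ℝ) < p := by exact_mod_cast hp
  have hg' : (0 : ℝ) < g := by exact_mod_cast hg
  have hnR : (2 * g * p : ℝ) < n := by exact_mod_cast hn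
  have hn' : (0 : ℝ) < n := lt_trans (by positivity) hnR
  have hn0 : 0 < n := by exact_mod_cast hn'
  have hnp : (2 * g : ℝ) ≤ n / p := by rw [le_div_iff₀ hp']; exact hnR.le
  have hpos : ∀ r : ℕ, 1 ≤ (2 * r + 1) * g := fun r => Nat.mul_pos (by omega) hg
  -- Each side contributes at most half of `π U₁`, since its `r`-th frequency is at distance at
  -- least `(2r + 1) g / n`.
  have hhalf : ∀ q : ℕ, q ≤ (n - 2 * g - 1) / (4 * g) + 1 → ∀ f : ℕ → ℝ,
      (∀ r < q, f r ≤ Real.pi / 2 * lobeSup ((2 * r + 1) * g)) →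
      ∑ r ∈ Finset.range q, f r ≤ Real.pi / 2 * leakageOne n g := by
    intro q hq f hf
    unfold leakageOne
    rw [Finset.mul_sum]
    refine (Finset.sum_le_sum fun r hr => hf r (Finset.mem_range.mp hr)).trans ?_
    refine Finset.sum_le_sum_of_subset_of_nonneg (Finset.range_mono hq) fun r _ _ => ?_
    exact mul_nonneg (by positivity) (lobeSup_nonneg (hpos r))
  rw [← Finset.sum_Ico_consecutive _ (show 1 ≤ p / 2 + 1 by omega)
    (show p / 2 + 1 ≤ p + 1 by omega)]
  have hright : ∑ i ∈ Finset.Ico 1 (p / 2 + 1), dirichlet n ((i : ℝ) / p - x) ≤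
      Real.pi / 2 * leakageOne n g := by
    rw [Finset.sum_Ico_eq_sum_range]
    apply hhalf
    · rcases Nat.eq_zero_or_pos (p / 2) with h | h
      · simp [h]
      · have := mem_range_leakageOne (r := p / 2 - 1) hg hn (by omega)
        omega
    · intro r hr
      have hr2 : (2 * (1 + r : ℕ) : ℝ) ≤ p := by exact_mod_cast (show 2 * (1 + r) ≤ p by omega)
      apply dirichlet_le_lobeSup hn0 (hpos r)
      · have : ((1 + r : ℕ) : ℝ) / p ≤ 1 / 2 := by rw [div_le_iff₀ hp']; linarith
        linarith
      · push_cast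
        have h1 : (1 + (r : ℝ)) / p - x ≥ (r + 1 / 2) / p := by
          have : x ≤ 1 / 2 / p := by rw [le_div_iff₀ hp']; linarith
          calc (1 + (r : ℝ)) / p - x ≥ (1 + (r : ℝ)) / p - 1 / 2 / p := by linarith
            _ = _ := by ring
        calc (2 * (r : ℝ) + 1) * g = 2 * g * (r + 1 / 2) := by ring
          _ ≤ n / p * (r + 1 / 2) := by gcongr
          _ = n * ((r + 1 / 2) / p) := by ring
          _ ≤ _ := by gcongr
  have hleft : ∑ i ∈ Finset.Ico (p / 2 + 1) (p + 1), dirichlet n ((i : ℝ) / p - x) ≤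
      Real.pi / 2 * leakageOne n g := by
    have hre : ∑ i ∈ Finset.Ico (p / 2 + 1) (p + 1), dirichlet n ((i : ℝ) / p - x) =
        ∑ i ∈ Finset.range (p - p / 2), dirichlet n ((i : ℝ) / p + x) := by
      refine Finset.sum_nbij' (fun i => p - i) (fun i => p - i) ?_ ?_ ?_ ?_ ?_
      · intro i hi; simp only [Finset.mem_Ico, Finset.mem_range] at hi ⊢; omega
      · intro i hi; simp only [Finset.mem_Ico, Finset.mem_range] at hi ⊢; omega
      · intro i hi; simp only [Finset.mem_Ico] at hi; omega
      · intro i hi; simp only [Finset.mem_range] at hi; omega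
      · intro i hi
        simp only [Finset.mem_Ico] at hi
        rw [← dirichlet_sub_div_sub n hp (by omega), Nat.sub_sub_self (by omega)]
    rw [hre]
    apply hhalf
    · have := mem_range_leakageOne (r := p - p / 2 - 1) hg hn (by omega)
      omega
    · intro r hr
      have hr2 : (2 * r + 1 : ℝ) ≤ p := by exact_mod_cast (show 2 * r + 1 ≤ p by omega)
      apply dirichlet_le_lobeSup hn0 (hpos r)
      · have : (r : ℝ) / p + x = (r + p * x) / p := by field_simp
        rw [this, div_le_iff₀ hp']
        linarith
      · push_cast
        calc (2 * (r : ℝ) + 1) * g = 2 * g * r + g := by ring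
          _ ≤ n / p * r + n * x := by gcongr
          _ = _ := by ring
  linarith

/-! ### Numerical bounds for the leakages -/

/-- The leading term of the leakage from the other frequencies near a frequency. -/
def nearLeakage (g m : ℕ) : ℝ := ∑ i ∈ Finset.Icc 1 m, 1 / (2 * (i : ℝ) * g)

/-- The subtracted term makes the induction telescope; `5/24` is chosen so that equality holds at `m
= 1`. -/
theorem sum_inv_cubic_le {m : ℕ} (hm : 1 ≤ m) :
    ∑ i ∈ Finset.Icc 1 m, 1 / (2 * (i : ℝ) * (4 * (i : ℝ) ^ 2 - 1)) ≤
      5 / 24 - 1 / (8 * (2 * (m : ℝ) + 1)) := by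
  induction m, hm using Nat.le_induction with
  | base => norm_num
  | succ m hm ih =>
    rw [Finset.sum_Icc_succ_top (by omega)]
    have hm' : (1 : ℝ) ≤ m := by exact_mod_cast hm
    have key : 1 / (2 * ((m : ℝ) + 1) * (4 * ((m : ℝ) + 1) ^ 2 - 1)) ≤
        1 / (8 * (2 * m + 1)) - 1 / (8 * (2 * (m + 1) + 1)) := by
      rw [show (4 * ((m : ℝ) + 1) ^ 2 - 1) = (2 * m + 1) * (2 * m + 3) by ring,
        div_sub_div _ _ (by positivity) (by positivity), div_le_div_iff₀ (by positivity)
        (by positivity)]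
      have : 0 ≤ ((m : ℝ) - 1) * ((2 * m + 1) * (2 * m + 3)) :=
        mul_nonneg (by linarith) (by positivity)
      nlinarith
    push_cast
    linarith

/-- The terms of first order in `ν` cancel between the two sides. With `r = ν / g`, partial
fractions leave `1 / (2 i g)` and a remainder quadratic in `r`, in whose denominator `r²` is
replaced by 1. -/
theorem near_term_le {g i : ℕ} (hg : 0 < g) (hi : 1 ≤ i) {ν : ℝ} (h0 : 0 ≤ ν) (h1 : ν ≤ g) :
    1 / (2 * (2 * i * g - ν)) + 1 / (2 * (2 * i * g + ν)) ≤
      1 / (2 * (i : ℝ) * g) + (ν / g) ^ 2 / g * (1 / (2 * (i : ℝ) * (4 * (i : ℝ) ^ 2 - 1))) := by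
  have hg' : (0 : ℝ) < g := by exact_mod_cast hg
  have hi' : (1 : ℝ) ≤ i := by exact_mod_cast hi
  obtain ⟨r, rfl⟩ : ∃ r, ν = r * g := ⟨ν / g, by field_simp⟩
  have hr0 : 0 ≤ r := by by_contra h; nlinarith
  have hr1 : r ≤ 1 := by by_contra h; nlinarith
  have ha : 0 < 2 * (i : ℝ) - r := by linarith
  have hb : 0 < 2 * (i : ℝ) + r := by linarith
  have hc : 0 < 4 * (i : ℝ) ^ 2 - 1 := by nlinarith
  have hd : 0 < 4 * (i : ℝ) ^ 2 - r ^ 2 := by nlinarith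
  rw [mul_div_cancel_right₀ _ hg'.ne']
  have e1 : 1 / (2 * (2 * i * g - r * g)) + 1 / (2 * (2 * i * g + r * g)) =
      1 / (2 * (i : ℝ) * g) + r ^ 2 / g * (1 / (2 * (i : ℝ) * (4 * (i : ℝ) ^ 2 - r ^ 2))) := by
    rw [show 2 * (2 * (i : ℝ) * g - r * g) = 2 * g * (2 * i - r) by ring,
      show 2 * (2 * (i : ℝ) * g + r * g) = 2 * g * (2 * i + r) by ring,
      show 4 * (i : ℝ) ^ 2 - r ^ 2 = (2 * i - r) * (2 * i + r) by ring]
    field_simp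
    ring
  rw [e1]
  gcongr
  nlinarith

theorem near_sum_le {g m : ℕ} (hg : 0 < g) (hm : 1 ≤ m) {ν : ℝ} (h0 : 0 ≤ ν) (h1 : ν ≤ g) :
    ∑ i ∈ Finset.Icc 1 m, (1 / (2 * (2 * i * g - ν)) + 1 / (2 * (2 * i * g + ν))) ≤
      nearLeakage g m + 5 / 24 * ((ν / g) ^ 2 / g) := by
  have h2 : ∀ i ∈ Finset.Icc 1 m, 1 / (2 * (2 * i * g - ν)) + 1 / (2 * (2 * i * g + ν)) ≤
      1 / (2 * (i : ℝ) * g) + (ν / g) ^ 2 / g * (1 / (2 * (i : ℝ) * (4 * (i : ℝ) ^ 2 - 1))) :=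
    fun i hi => near_term_le hg (Finset.mem_Icc.mp hi).1 h0 h1
  refine (Finset.sum_le_sum h2).trans ?_
  rw [Finset.sum_add_distrib, ← Finset.mul_sum]
  unfold nearLeakage
  have h3 := sum_inv_cubic_le hm
  have h4 : (0 : ℝ) ≤ 1 / (8 * (2 * (m : ℝ) + 1)) := by positivity
  have h5 : 0 ≤ (ν / g) ^ 2 / g := by positivity
  nlinarith

theorem inv_le_nearLeakage {g m : ℕ} (hm : 1 ≤ m) : 1 / (2 * g : ℝ) ≤ nearLeakage g m := by
  have := Finset.single_le_sum (f := fun i : ℕ => 1 / (2 * (i : ℝ) * g)) (s := Finset.Icc 1 m)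
    (fun i _ => by positivity) (Finset.mem_Icc.mpr ⟨le_rfl, hm⟩)
  simpa [nearLeakage] using this

theorem leakageTwo_nonneg {n g : ℕ} (hg : 0 < g) : 0 ≤ leakageTwo n g := by
  refine Finset.sum_nonneg fun i hi => lobeSup_nonneg ?_
  have := Nat.mul_le_mul (Finset.mem_Icc.mp hi).1 hg
  have h2 : 2 * i * g = 2 * (i * g) := by ring
  omega

theorem leakageOne_nonneg {n g : ℕ} (hg : 0 < g) : 0 ≤ leakageOne n g :=
  Finset.sum_nonneg fun _ _ => lobeSup_nonneg (Nat.mul_pos (by omega) hg)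

/-- There are at most `g / 4` terms because `n ≤ g²`, each at most `1 / (2g - 1) ≤ 1 / g`. This
makes the denominator `1 - π U₂` of the threshold positive. -/
theorem pi_mul_leakageTwo_le {n g : ℕ} (hg : 0 < g) (hn : n ≤ g ^ 2) :
    Real.pi * leakageTwo n g ≤ 1 / 4 := by
  have hg' : (1 : ℝ) ≤ g := by exact_mod_cast hg
  unfold leakageTwo
  rw [Finset.mul_sum]
  have hterm : ∀ i ∈ Finset.Icc 1 ((n - 1) / (4 * g)),
      Real.pi * lobeSup (2 * i * g - 1) ≤ 1 / (2 * g - 1) := by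
    intro i hi
    have hi1 := (Finset.mem_Icc.mp hi).1
    have h1 : 2 * g ≤ 2 * i * g := by nlinarith
    have h2 : 1 ≤ 2 * i * g - 1 := by omega
    have h3 : (2 * g - 1 : ℝ) ≤ ((2 * i * g - 1 : ℕ) : ℝ) := by
      rw [Nat.cast_sub (by omega)]
      have : ((2 * g : ℕ) : ℝ) ≤ ((2 * i * g : ℕ) : ℝ) := by exact_mod_cast h1
      push_cast at this ⊢
      linarith
    have hpi := Real.pi_pos
    calc Real.pi * lobeSup (2 * i * g - 1)
        ≤ Real.pi * (1 / (Real.pi * ((2 * i * g - 1 : ℕ) : ℝ))) := by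
          gcongr
          exact lobeSup_le h2
      _ = 1 / ((2 * i * g - 1 : ℕ) : ℝ) := by field_simp
      _ ≤ 1 / (2 * g - 1) := one_div_le_one_div_of_le (by linarith) h3
  refine (Finset.sum_le_sum hterm).trans ?_
  rw [Finset.sum_const, Nat.card_Icc, nsmul_eq_mul, Nat.add_sub_cancel]
  have hJ : 4 * (((n - 1) / (4 * g) : ℕ) : ℝ) ≤ g := by
    have : 4 * ((n - 1) / (4 * g)) ≤ g := by
      have h1 := Nat.div_mul_le_self (n - 1) (4 * g)
      by_contra h
      push Not at h
      nlinarith [Nat.sub_le n 1]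
    exact_mod_cast this
  rw [mul_one_div, div_le_iff₀ (by linarith)]
  linarith

/-- Each lobe midpoint gives `1 / (2 i g - 1/2)`, more than `1 / (2 i g)`. The surplus at `i = 1` is
at least `1 / (8 g²)` and pays for the quadratic remainder when `ν ≤ 1`. -/
theorem nearLeakage_add_le_pi_mul_leakageTwo {n g p : ℕ} (hg : 0 < g) (hp : 2 ≤ p)
    (hn : 2 * g * p < n) :
    nearLeakage g (p / 2) + 1 / (8 * (g : ℝ) ^ 2) ≤ Real.pi * leakageTwo n g := by
  have hg' : (1 : ℝ) ≤ g := by exact_mod_cast hg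
  have hpi := Real.pi_pos
  have hm : 1 ≤ p / 2 := by omega
  have hsub : p / 2 ≤ (n - 1) / (4 * g) := by
    rw [Nat.le_div_iff_mul_le (by omega)]
    have h1 : 2 * g * (2 * (p / 2)) ≤ 2 * g * p := by
      gcongr
      omega
    have h2 : p / 2 * (4 * g) = 2 * g * (2 * (p / 2)) := by ring
    omega
  have hterm : ∀ i ∈ Finset.Icc 1 (p / 2),
      1 / (2 * (i : ℝ) * g) + (if i = 1 then 1 / (8 * (g : ℝ) ^ 2) else 0) ≤
        Real.pi * lobeSup (2 * i * g - 1) := by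
    intro i hi
    have hi1 := (Finset.mem_Icc.mp hi).1
    have hi' : (1 : ℝ) ≤ i := by exact_mod_cast hi1
    have h1 : 2 * g ≤ 2 * i * g := by nlinarith
    have h2 : 1 ≤ 2 * i * g - 1 := by omega
    have h3 : 1 / (2 * i * g - 1 / 2) ≤ Real.pi * lobeSup (2 * i * g - 1) := by
      calc (1 : ℝ) / (2 * i * g - 1 / 2)
          = Real.pi * (1 / (Real.pi * (((2 * i * g - 1 : ℕ) : ℝ) + 1 / 2))) := by
            rw [Nat.cast_sub (by omega)]
            push_cast
            rw [show (2 : ℝ) * i * g - 1 + 1 / 2 = 2 * i * g - 1 / 2 by ring]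
            field_simp
        _ ≤ _ := by
            gcongr
            exact le_lobeSup_mid h2
    refine le_trans ?_ h3
    have hig : (1 : ℝ) ≤ i * g := by nlinarith
    split_ifs with h
    · subst h
      rw [div_add_div _ _ (by positivity) (by positivity), div_le_div_iff₀ (by positivity)
        (by push_cast; linarith)]
      push_cast
      nlinarith
    · rw [add_zero]
      apply one_div_le_one_div_of_le <;> linarith
  unfold leakageTwo nearLeakage
  rw [Finset.mul_sum]
  calc _ = ∑ i ∈ Finset.Icc 1 (p / 2),
        (1 / (2 * (i : ℝ) * g) + (if i = 1 then 1 / (8 * (g : ℝ) ^ 2) else 0)) := by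
        rw [Finset.sum_add_distrib, Finset.sum_ite_eq', if_pos (Finset.mem_Icc.mpr ⟨le_rfl, hm⟩)]
    _ ≤ ∑ i ∈ Finset.Icc 1 (p / 2), Real.pi * lobeSup (2 * i * g - 1) := Finset.sum_le_sum hterm
    _ ≤ _ := by
      refine Finset.sum_le_sum_of_subset_of_nonneg (Finset.Icc_subset_Icc_right hsub) ?_
      intro i hi _
      refine mul_nonneg hpi.le (lobeSup_nonneg ?_)
      have h1 := (Finset.mem_Icc.mp hi).1
      have : 2 * g ≤ 2 * i * g := by nlinarith
      omega

/-- The surplus comes from `r = 0` alone: `1 / (g + 1/2) - 1 / (2g) ≥ 2 / (5g)` as soon as `g ≥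
9/2`. -/
theorem nearLeakage_add_le_pi_mul_leakageOne {n g p : ℕ} (hg : 5 ≤ g) (hp : 2 ≤ p)
    (hn : 2 * g * p < n) :
    nearLeakage g (p / 2) + 2 / (5 * (g : ℝ)) ≤ Real.pi * leakageOne n g := by
  have hg' : (5 : ℝ) ≤ g := by exact_mod_cast hg
  have hpi := Real.pi_pos
  have hm : 1 ≤ p / 2 := by omega
  have hterm : ∀ r ∈ Finset.range (p / 2),
      1 / (2 * ((r + 1 : ℕ) : ℝ) * g) + (if r = 0 then 2 / (5 * (g : ℝ)) else 0) ≤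
        Real.pi * lobeSup ((2 * r + 1) * g) := by
    intro r hr
    have h2 : 1 ≤ (2 * r + 1) * g := Nat.mul_pos (by omega) (by omega)
    have h3 : 1 / ((2 * r + 1) * g + 1 / 2) ≤ Real.pi * lobeSup ((2 * r + 1) * g) := by
      calc (1 : ℝ) / ((2 * r + 1) * g + 1 / 2)
          = Real.pi * (1 / (Real.pi * ((((2 * r + 1) * g : ℕ) : ℝ) + 1 / 2))) := by
            push_cast
            field_simp
        _ ≤ _ := by
            gcongr
            exact le_lobeSup_mid h2
    refine le_trans ?_ h3
    have hr0 : (0 : ℝ) ≤ r := Nat.cast_nonneg r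
    split_ifs with h
    · subst h
      rw [div_add_div _ _ (by positivity) (by positivity), div_le_div_iff₀ (by positivity)
        (by push_cast; linarith)]
      push_cast
      nlinarith
    · rw [add_zero]
      push_cast
      apply one_div_le_one_div_of_le
      · nlinarith
      · linarith
  unfold leakageOne nearLeakage
  rw [Finset.mul_sum, ← Finset.Ico_add_one_right_eq_Icc, Finset.sum_Ico_eq_sum_range,
    Nat.add_sub_cancel]
  calc _ = ∑ r ∈ Finset.range (p / 2),
        (1 / (2 * ((r + 1 : ℕ) : ℝ) * g) + (if r = 0 then 2 / (5 * (g : ℝ)) else 0)) := by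
        rw [Finset.sum_add_distrib, Finset.sum_ite_eq', if_pos (Finset.mem_range.mpr hm)]
        simp only [add_comm 1]
    _ ≤ ∑ r ∈ Finset.range (p / 2), Real.pi * lobeSup ((2 * r + 1) * g) := Finset.sum_le_sum hterm
    _ ≤ _ := by
      refine Finset.sum_le_sum_of_subset_of_nonneg (Finset.range_mono ?_) ?_
      · have := mem_range_leakageOne (r := p / 2 - 1) (by omega) hn (by omega)
        omega
      · intro r _ _
        exact mul_nonneg hpi.le (lobeSup_nonneg (Nat.mul_pos (by omega) (by omega)))

/-! ### The transform of a periodic signal -/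

/-- The finite Fourier transform of `f` over the epochs `n k + 1, …, n (k + 1)`. -/
def transform (n k : ℕ) (f : ℕ → ℝ) (v : ℝ) : ℂ :=
  (1 / (n : ℂ)) * ∑ s ∈ Finset.Icc (n * k + 1) (n * (k + 1)),
    (f s : ℂ) * Complex.exp (-(2 * Real.pi * Complex.I * v * s))

theorem periodogram_eq_norm (n k : ℕ) (y : ℕ → ℝ) (v : ℝ) :
    periodogram n k y v = ‖transform n k y v‖ := rfl

theorem transform_sub (n k : ℕ) (f h : ℕ → ℝ) (v : ℝ) :
    transform n k (fun s => f s - h s) v = transform n k f v - transform n k h v := by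
  unfold transform
  rw [← mul_sub, ← Finset.sum_sub_distrib]
  congr 1
  refine Finset.sum_congr rfl fun s _ => ?_
  push_cast
  ring

theorem continuous_periodogram (n k : ℕ) (y : ℕ → ℝ) : Continuous (periodogram n k y) := by
  unfold periodogram
  fun_prop

theorem sum_Icc_epochs {M : Type*} [AddCommMonoid M] (n k : ℕ) (f : ℕ → M) :
    ∑ s ∈ Finset.Icc (n * k + 1) (n * (k + 1)), f s = ∑ i ∈ Finset.range n, f (n * k + 1 + i) := by
  rw [← Finset.Ico_add_one_right_eq_Icc, Finset.sum_Ico_eq_sum_range]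
  congr 2
  rw [mul_add]
  omega

theorem norm_kernel (n k : ℕ) (x : ℝ) :
    ‖(1 / (n : ℂ)) * ∑ s ∈ Finset.Icc (n * k + 1) (n * (k + 1)),
      Complex.exp (2 * Real.pi * Complex.I * x * s)‖ = dirichlet n x := by
  rw [sum_Icc_epochs]
  have : ∀ i : ℕ, Complex.exp (2 * Real.pi * Complex.I * x * (n * k + 1 + i : ℕ)) =
      Complex.exp (2 * Real.pi * Complex.I * x * (n * k + 1 : ℕ)) *
        Complex.exp (2 * Real.pi * Complex.I * x * i) := by
    intro i
    rw [← Complex.exp_add]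
    congr 1
    push_cast
    ring
  simp_rw [this]
  rw [← Finset.mul_sum, mul_left_comm, norm_mul, norm_exp_two_pi_mul_nat, one_mul]
  rfl

theorem transform_eq_sum {m : ℕ → ℝ} {p : ℕ} (hp : 0 < p) (hm : Function.Periodic m p)
    (n k : ℕ) (v : ℝ) :
    transform n k m v = ∑ j ∈ Finset.range p, fourierCoeff m p j *
      ((1 / (n : ℂ)) * ∑ s ∈ Finset.Icc (n * k + 1) (n * (k + 1)),
        Complex.exp (2 * Real.pi * Complex.I * ((j / p - v : ℝ) : ℂ) * s)) := by
  unfold transform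
  simp_rw [fourierCoeff_representation m p hp hm, Finset.sum_mul, Finset.mul_sum]
  rw [Finset.sum_comm]
  refine Finset.sum_congr rfl fun j _ => Finset.sum_congr rfl fun s _ => ?_
  rw [mul_assoc, ← Complex.exp_add, mul_left_comm]
  congr 3
  push_cast
  ring

theorem abs_norm_sum_sub_le {ι : Type*} [DecidableEq ι] {s : Finset ι} {c : ι} (hc : c ∈ s)
    (f : ι → ℂ) : |‖∑ j ∈ s, f j‖ - ‖f c‖| ≤ ∑ j ∈ s.erase c, ‖f j‖ := by
  refine (abs_norm_sub_norm_le _ _).trans ?_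
  rw [← Finset.add_sum_erase s f hc, add_sub_cancel_left]
  exact norm_sum_le _ _

theorem finite_presentMagnitudes (m : ℕ → ℝ) (p : ℕ) : (presentMagnitudes m p).Finite := by
  refine ((Finset.range p).finite_toSet.image fun j => ‖fourierCoeff m p j‖).subset ?_
  rintro a ⟨_, j, hj, rfl⟩
  exact ⟨j, by simpa using hj, rfl⟩

theorem maxMagnitude_nonneg (m : ℕ → ℝ) (p : ℕ) : 0 ≤ maxMagnitude m p :=
  Real.sSup_nonneg fun _ h => h.1.le

theorem norm_fourierCoeff_le (m : ℕ → ℝ) {p j : ℕ} (hj : j < p) :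
    ‖fourierCoeff m p j‖ ≤ maxMagnitude m p := by
  rcases (norm_nonneg (fourierCoeff m p j)).eq_or_lt with h | h
  · rw [← h]; exact maxMagnitude_nonneg m p
  · exact le_csSup (finite_presentMagnitudes m p).bddAbove ⟨h, j, hj, rfl⟩

theorem fourierCoeff_sub (m : ℕ → ℝ) {p j : ℕ} (hp : 0 < p) (hj : j ≤ p) :
    fourierCoeff m p (p - j) = (starRingEnd ℂ) (fourierCoeff m p j) := by
  have hp' : (p : ℂ) ≠ 0 := by exact_mod_cast hp.ne'
  unfold fourierCoeff
  simp only [map_mul, map_div₀, map_one, Complex.conj_natCast, map_sum, ← Complex.exp_conj,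
    Complex.conj_I, Complex.conj_ofReal, map_ofNat, map_neg]
  congr 1
  refine Finset.sum_congr rfl fun t _ => ?_
  congr 1
  rw [Complex.exp_eq_exp_iff_exists_int]
  refine ⟨-(t : ℤ), ?_⟩
  push_cast [hj]
  field_simp
  ring

theorem norm_fourierCoeff_sub (m : ℕ → ℝ) {p j : ℕ} (hp : 0 < p) (hj : j ≤ p) :
    ‖fourierCoeff m p (p - j)‖ = ‖fourierCoeff m p j‖ := by
  rw [fourierCoeff_sub m hp hj, Complex.norm_conj]

/-- The means are real, so `b_{p-j}` is the conjugate of `b_j` and the strongest frequency is also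
attained in `[0, 1/2]`, the range that the threshold inspects. -/
theorem exists_norm_fourierCoeff_eq (m : ℕ → ℝ) {p : ℕ} (hp : 0 < p) :
    maxMagnitude m p = 0 ∨ ∃ j, 2 * j ≤ p ∧ ‖fourierCoeff m p j‖ = maxMagnitude m p := by
  rcases (presentMagnitudes m p).eq_empty_or_nonempty with h | h
  · left; simp [maxMagnitude, h]
  · right
    obtain ⟨_, j, hj, hj'⟩ := h.csSup_mem (finite_presentMagnitudes m p)
    rcases le_total (2 * j) p with h2 | h2
    · exact ⟨j, h2, hj'.symm⟩
    · refine ⟨p - j, by omega, ?_⟩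
      rw [norm_fourierCoeff_sub m hp hj.le]
      exact hj'.symm

theorem abs_periodogram_sub_le {m : ℕ → ℝ} {p c : ℕ} (hc : c < p) (hm : Function.Periodic m p)
    (n k : ℕ) (v : ℝ) :
    |periodogram n k m v - ‖fourierCoeff m p c‖ * dirichlet n (v - c / p)| ≤
      maxMagnitude m p * ∑ i ∈ Finset.Ico 1 p, dirichlet n (i / p - (v - c / p)) := by
  have hp' : (p : ℝ) ≠ 0 := by exact_mod_cast (by omega : p ≠ 0)
  have hF : ∀ i : ℕ, dirichlet n (((i + p : ℕ) : ℝ) / p - v) = dirichlet n ((i : ℝ) / p - v) := by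
    intro i
    rw [← dirichlet_add_one n ((i : ℝ) / p - v)]
    congr 1
    push_cast
    field_simp
    ring
  have h1 := abs_norm_sum_sub_le (Finset.mem_range.mpr hc) fun j => fourierCoeff m p j *
      ((1 / (n : ℂ)) * ∑ s ∈ Finset.Icc (n * k + 1) (n * (k + 1)),
        Complex.exp (2 * Real.pi * Complex.I * ((j / p - v : ℝ) : ℂ) * s))
  rw [← transform_eq_sum (by omega) hm, ← periodogram_eq_norm] at h1
  simp only [norm_mul (fourierCoeff _ _ _), norm_kernel] at h1
  rw [show dirichlet n ((c : ℝ) / p - v) = dirichlet n (v - c / p) by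
    rw [← dirichlet_neg, neg_sub]] at h1
  refine h1.trans ?_
  have h2 := sum_erase_of_periodic (F := fun j : ℕ => dirichlet n ((j : ℝ) / p - v)) hF hc
  have h3 : ∑ i ∈ Finset.Ico 1 p, dirichlet n (i / p - (v - c / p)) =
      ∑ j ∈ (Finset.range p).erase c, dirichlet n ((j : ℝ) / p - v) := by
    rw [h2]
    refine Finset.sum_congr rfl fun i _ => ?_
    congr 1
    push_cast
    field_simp
    ring
  rw [h3, Finset.mul_sum]
  refine Finset.sum_le_sum fun j hj => ?_
  have := norm_fourierCoeff_le m (Finset.mem_range.mp (Finset.mem_of_mem_erase hj))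
  have := dirichlet_nonneg n ((j : ℝ) / p - v)
  gcongr

/-- On `[0, 1/2]` a frequency `c / p` closest to `v` satisfies `c ≤ p / 2`. -/
theorem exists_nearest {p : ℕ} (hp : 0 < p) {v : ℝ} (h0 : 0 ≤ v) (h1 : v ≤ 1 / 2) :
    ∃ c : ℕ, 2 * c ≤ p ∧ p * |v - c / p| ≤ 1 / 2 := by
  have hp' : (0 : ℝ) < p := by exact_mod_cast hp
  have key : ∀ c : ℕ, |p * v - c| ≤ 1 / 2 → p * |v - c / p| ≤ 1 / 2 := by
    intro c hc
    calc p * |v - c / p| = |p * (v - c / p)| := by rw [abs_mul, abs_of_pos hp']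
      _ = |p * v - c| := by congr 1; field_simp
      _ ≤ _ := hc
  rcases le_or_gt (p * v) (1 / 2) with h | h
  · refine ⟨0, by omega, key 0 ?_⟩
    rw [Nat.cast_zero, sub_zero, abs_of_nonneg (by positivity)]
    exact h
  · have ha := Nat.le_ceil (p * v - 1 / 2)
    have hb := Nat.ceil_lt_add_one (by linarith : 0 ≤ p * v - 1 / 2)
    -- Rounding half-integers down keeps `2 c ≤ p` when `v = 1/2` and `p` is odd.
    refine ⟨⌈p * v - 1 / 2⌉₊, ?_, key _ (abs_le.mpr ⟨by linarith, by linarith⟩)⟩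
    have : ((2 * ⌈p * v - 1 / 2⌉₊ : ℕ) : ℝ) < ((p + 1 : ℕ) : ℝ) := by
      push_cast
      nlinarith
    have h2 : 2 * ⌈p * v - 1 / 2⌉₊ < p + 1 := by exact_mod_cast this
    omega

/-! ### An arm on whose epochs the noise is small -/

/-- The rewards `y` of arm `k` are the periodic means `m` up to noise whose transform is
smaller than `3 / 4` of the noise level. -/
structure GoodArm (n g k p : ℕ) (σ H : ℝ) (m y : ℕ → ℝ) : Prop where
  two_le : 2 ≤ g
  le_sq : n ≤ g ^ 2
  period : IsMinimalPeriod m p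
  lt : 2 * g * p < n
  magnitude : MagnitudeCondition n g σ H m p
  noise : ∀ v, ‖transform n k (fun s => y s - m s) v‖ < 3 / 4 * noiseLevel n σ H

namespace GoodArm

variable {n g k p : ℕ} {σ H : ℝ} {m y : ℕ → ℝ}

theorem p_pos (h : GoodArm n g k p σ H m y) : 0 < p := h.period.1.1

theorem g_pos (h : GoodArm n g k p σ H m y) : 0 < g := by have := h.two_le; omega

theorem n_pos (h : GoodArm n g k p σ H m y) : 0 < n := by have := h.lt; omega

theorem periodic (h : GoodArm n g k p σ H m y) : Function.Periodic m p := h.period.1.2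

/-- Here `4 g ≤ 2 g p < n ≤ g²`. -/
theorem five_le (h : GoodArm n g k p σ H m y) (hp : 2 ≤ p) : 5 ≤ g := by
  have h1 := h.lt
  have h2 := h.le_sq
  have h3 : 2 * g * 2 ≤ 2 * g * p := by gcongr
  by_contra h4
  push Not at h4
  interval_cases g <;> omega

theorem noiseLevel_pos (h : GoodArm n g k p σ H m y) : 0 < noiseLevel n σ H := by
  have := (norm_nonneg _).trans_lt (h.noise 0)
  linarith

theorem abs_periodogram_sub_lt (h : GoodArm n g k p σ H m y) (v : ℝ) :
    |periodogram n k y v - periodogram n k m v| < 3 / 4 * noiseLevel n σ H := by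
  have h1 := h.noise v
  rw [transform_sub] at h1
  exact (abs_norm_sub_norm_le _ _).trans_lt h1

/-! ### Leakage around a frequency in terms of `U₁` and `U₂` -/

theorem leakage_le (h : GoodArm n g k p σ H m y) {δ : ℝ} (hδ : n * |δ| ≤ g) :
    ∑ i ∈ Finset.Ico 1 p, dirichlet n ((i : ℝ) / p - δ) ≤
      nearLeakage g (p / 2) + 5 / 24 * ((n * |δ| / g) ^ 2 / g) := by
  have hg := h.g_pos
  rcases (show 1 ≤ p from h.p_pos).eq_or_lt with hp | hp
  · subst hp
    simp [nearLeakage]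
    positivity
  · exact (sum_Ico_dirichlet_le_near hg h.p_pos h.lt hδ).trans
      (near_sum_le hg (by omega) (by positivity) hδ)

theorem leakage_le_one (h : GoodArm n g k p σ H m y) {δ : ℝ} (hδ : n * |δ| ≤ g) :
    ∑ i ∈ Finset.Ico 1 p, dirichlet n ((i : ℝ) / p - δ) ≤ Real.pi * leakageOne n g := by
  have hg := h.g_pos
  rcases (show 1 ≤ p from h.p_pos).eq_or_lt with hp | hp
  · subst hp
    simpa using mul_nonneg Real.pi_pos.le (leakageOne_nonneg hg)
  · have hg' : (0 : ℝ) < g := by exact_mod_cast hg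
    have h1 := nearLeakage_add_le_pi_mul_leakageOne (h.five_le hp) hp h.lt
    refine (h.leakage_le hδ).trans (le_trans ?_ h1)
    have h2 : n * |δ| / g ≤ 1 := by rw [div_le_one hg']; exact hδ
    have h3 : (n * |δ| / g) ^ 2 ≤ 1 := pow_le_one₀ (by positivity) h2
    have h4 : (n * |δ| / g) ^ 2 / g ≤ 1 / g := by gcongr
    have h5 : (0 : ℝ) < 1 / g := by positivity
    have h6 : 2 / (5 * (g : ℝ)) = 2 / 5 * (1 / g) := by field_simp
    rw [h6]
    linarith

theorem leakage_le_two (h : GoodArm n g k p σ H m y) {δ : ℝ} (hδ : n * |δ| ≤ 1) :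
    ∑ i ∈ Finset.Ico 1 p, dirichlet n ((i : ℝ) / p - δ) ≤ Real.pi * leakageTwo n g := by
  have hg := h.g_pos
  rcases (show 1 ≤ p from h.p_pos).eq_or_lt with hp | hp
  · subst hp
    simpa using mul_nonneg Real.pi_pos.le (leakageTwo_nonneg hg)
  · have hg' : (2 : ℝ) ≤ g := by exact_mod_cast h.two_le
    have h1 := nearLeakage_add_le_pi_mul_leakageTwo hg hp h.lt
    refine (h.leakage_le (hδ.trans (by linarith))).trans (le_trans ?_ h1)
    have h3 : (n * |δ|) ^ 2 ≤ 1 := pow_le_one₀ (by positivity) hδ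
    have h4 : (n * |δ| / g) ^ 2 / g ≤ 1 / g ^ 2 * (1 / 2) := by
      rw [div_pow, div_div, div_mul_div_comm, one_mul]
      gcongr
    have h6 : 1 / (8 * (g : ℝ) ^ 2) = 1 / 8 * (1 / g ^ 2) := by field_simp
    have h5 : (0 : ℝ) < 1 / g ^ 2 := by positivity
    rw [h6]
    linarith

theorem leakage_le_half (h : GoodArm n g k p σ H m y) {δ : ℝ} (hδ : n * |δ| ≤ g) :
    ∑ i ∈ Finset.Ico 1 p, dirichlet n ((i : ℝ) / p - δ) ≤
      Real.pi * leakageTwo n g + 1 / 2 := by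
  have hg := h.g_pos
  rcases (show 1 ≤ p from h.p_pos).eq_or_lt with hp | hp
  · subst hp
    have := mul_nonneg Real.pi_pos.le (leakageTwo_nonneg (n := n) hg)
    simp
    linarith
  · have hg' : (2 : ℝ) ≤ g := by exact_mod_cast h.two_le
    have h1 := nearLeakage_add_le_pi_mul_leakageTwo hg hp h.lt
    have h2 : n * |δ| / g ≤ 1 := by rw [div_le_one (by linarith)]; exact hδ
    have h3 : (n * |δ| / g) ^ 2 ≤ 1 := pow_le_one₀ (by positivity) h2
    have h4 : (n * |δ| / g) ^ 2 / g ≤ 1 / 2 := by gcongr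
    have h5 : (0 : ℝ) < 1 / (8 * (g : ℝ) ^ 2) := by positivity
    have := h.leakage_le hδ
    linarith

theorem leakageTwo_bounds (h : GoodArm n g k p σ H m y) :
    0 ≤ Real.pi * leakageTwo n g ∧ Real.pi * leakageTwo n g ≤ 1 / 4 :=
  ⟨mul_nonneg Real.pi_pos.le (leakageTwo_nonneg h.g_pos), pi_mul_leakageTwo_le h.g_pos h.le_sq⟩

theorem leakageOne_nonneg (h : GoodArm n g k p σ H m y) : 0 ≤ Real.pi * leakageOne n g :=
  mul_nonneg Real.pi_pos.le (PeriodicBandit.leakageOne_nonneg h.g_pos)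

/-- Away from the present frequencies the signal has a small periodogram. -/
theorem signal_le_of_far (h : GoodArm n g k p σ H m y) {v : ℝ} {c : ℕ} (hc : 2 * c ≤ p)
    (hv : p * |v - c / p| ≤ 1 / 2)
    (hfar : fourierCoeff m p c = 0 ∨ g ≤ n * |v - c / p|) :
    periodogram n k m v ≤ maxMagnitude m p * (Real.pi * leakageOne n g) := by
  have hp := h.p_pos
  have hB := maxMagnitude_nonneg m p
  have h1 := abs_periodogram_sub_le (by omega : c < p) h.periodic n k v
  have h2 := (abs_le.mp h1).2
  rcases le_or_gt (g : ℝ) (n * |v - c / p|) with hg | hg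
  · have h3 := sum_range_dirichlet_le_far h.g_pos hp h.lt hg hv
    rw [Finset.range_eq_Ico, Finset.sum_eq_sum_Ico_succ_bot hp, Nat.cast_zero, zero_div, zero_sub,
      dirichlet_neg, zero_add] at h3
    have h4 := norm_fourierCoeff_le m (by omega : c < p)
    have h5 := mul_le_mul_of_nonneg_right h4 (dirichlet_nonneg n (v - c / p))
    have h6 := mul_le_mul_of_nonneg_left h3 hB
    linarith
  · have h3 : fourierCoeff m p c = 0 := by
      rcases hfar with h | h
      · exact h
      · linarith
    rw [h3, norm_zero, zero_mul, sub_zero] at h2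
    exact h2.trans (mul_le_mul_of_nonneg_left (h.leakage_le_one hg.le) hB)

/-- Three ranges of the distance `ν / n` to the nearest frequency: for `ν ≥ g` all of the signal is
leakage; for `ν ≤ 1` the kernel is at most 1 and the rest at most `π U₂`; in between the kernel is
at most `1/2`, which makes room for the extra `1/2` in `leakage_le_half`. -/
theorem signal_le (h : GoodArm n g k p σ H m y) {v : ℝ} (h0 : 0 ≤ v) (h1 : v ≤ 1 / 2) :
    periodogram n k m v ≤ maxMagnitude m p *
      max (Real.pi * leakageOne n g) (Real.pi * leakageTwo n g + 1) := by
  have hp := h.p_pos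
  have hB := maxMagnitude_nonneg m p
  obtain ⟨c, hc, hv⟩ := exists_nearest hp h0 h1
  rcases le_or_gt (g : ℝ) (n * |v - c / p|) with hg | hg
  · exact (h.signal_le_of_far hc hv (Or.inr hg)).trans
      (mul_le_mul_of_nonneg_left (le_max_left _ _) hB)
  · refine le_trans ?_ (mul_le_mul_of_nonneg_left (le_max_right _ _) hB)
    have h1 := (abs_le.mp (abs_periodogram_sub_le (by omega : c < p) h.periodic n k v)).2
    have h4 := norm_fourierCoeff_le m (by omega : c < p)
    have h5 := mul_le_mul_of_nonneg_right h4 (dirichlet_nonneg n (v - c / p))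
    have h6 : dirichlet n (v - c / p) + ∑ i ∈ Finset.Ico 1 p, dirichlet n (i / p - (v - c / p)) ≤
        Real.pi * leakageTwo n g + 1 := by
      rcases le_or_gt (n * |v - c / p|) 1 with h7 | h7
      · have := h.leakage_le_two h7
        have := dirichlet_le_one n (v - c / p)
        linarith
      · have h8 := h.leakage_le_half hg.le
        have h9 : dirichlet n (v - c / p) ≤ 1 / 2 := by
          have hpR : (1 : ℝ) ≤ p := by exact_mod_cast hp
          have e : dirichlet n (v - c / p) = dirichlet n |v - c / p| := by
            rcases abs_cases (v - c / p) with ⟨h, _⟩ | ⟨h, _⟩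
            · rw [h]
            · rw [h, dirichlet_neg]
          rw [e]
          have hpos : 0 < |v - c / p| := by
            by_contra hh
            have : |v - c / p| = 0 := le_antisymm (not_lt.mp hh) (abs_nonneg _)
            rw [this] at h7
            linarith
          refine (dirichlet_le_inv h.n_pos hpos (by nlinarith)).trans ?_
          gcongr
          linarith
        linarith
    have h10 := mul_le_mul_of_nonneg_left h6 hB
    linarith

theorem le_signal (h : GoodArm n g k p σ H m y) {j : ℕ} (hj : 2 * j ≤ p) :
    ‖fourierCoeff m p j‖ - maxMagnitude m p *
      ∑ i ∈ Finset.Ico 1 p, dirichlet n ((i : ℝ) / p - 0) ≤ periodogram n k m (j / p) := by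
  have hp := h.p_pos
  have h1 := (abs_le.mp (abs_periodogram_sub_le (by omega : j < p) h.periodic n k (j / p))).1
  have hn : (n : ℂ) ≠ 0 := by exact_mod_cast h.n_pos.ne'
  have h2 : dirichlet n 0 = 1 := by
    unfold dirichlet
    simp [hn]
  rw [sub_self, h2, mul_one] at h1
  linarith

theorem le_signal_leakageTwo (h : GoodArm n g k p σ H m y) {j : ℕ} (hj : 2 * j ≤ p) :
    ‖fourierCoeff m p j‖ - maxMagnitude m p * (Real.pi * leakageTwo n g) ≤
      periodogram n k m (j / p) := by
  have h1 := h.le_signal hj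
  have h2 := mul_le_mul_of_nonneg_left (h.leakage_le_two (δ := 0) (by simp))
    (maxMagnitude_nonneg m p)
  linarith

theorem div_mem_Icc (h : GoodArm n g k p σ H m y) {j : ℕ} (hj : 2 * j ≤ p) :
    (j : ℝ) / p ∈ Set.Icc (0 : ℝ) (1 / 2) := by
  have hp' : (0 : ℝ) < p := by exact_mod_cast h.p_pos
  refine ⟨by positivity, ?_⟩
  rw [div_le_iff₀ hp']
  have : (2 * j : ℝ) ≤ p := by exact_mod_cast hj
  linarith

/-! ### The threshold and the initial domain -/

theorem periodogram_le (h : GoodArm n g k p σ H m y) {v : ℝ} (hv : v ∈ Set.Icc (0 : ℝ) (1 / 2)) :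
    periodogram n k y v ≤ 3 / 4 * noiseLevel n σ H + maxMagnitude m p *
      max (Real.pi * leakageOne n g) (Real.pi * leakageTwo n g + 1) := by
  have h1 := (abs_lt.mp (h.abs_periodogram_sub_lt v)).2
  have h2 := h.signal_le hv.1 hv.2
  linarith

/-- At the strongest frequency the periodogram is at least `(1 - π U₂) B - 3/4 ε̄`. Hence `(ε̄ +
sup) / (1 - π U₂)` is an observable upper bound for `B`, which explains the form of the threshold.
-/
theorem le_threshold (h : GoodArm n g k p σ H m y) :
    noiseLevel n σ H + Real.pi * leakageOne n g * maxMagnitude m p ≤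
      threshold n g σ H (periodogram n k y) := by
  have hu2 := h.leakageTwo_bounds
  have hu1 := h.leakageOne_nonneg
  have he := h.noiseLevel_pos
  have hbdd : BddAbove (periodogram n k y '' Set.Icc (0 : ℝ) (1 / 2)) := by
    refine ⟨3 / 4 * noiseLevel n σ H + maxMagnitude m p *
      max (Real.pi * leakageOne n g) (Real.pi * leakageTwo n g + 1), ?_⟩
    rintro _ ⟨v, hv, rfl⟩
    exact h.periodogram_le hv
  have hsup : (1 - Real.pi * leakageTwo n g) * maxMagnitude m p ≤
      noiseLevel n σ H + sSup (periodogram n k y '' Set.Icc (0 : ℝ) (1 / 2)) := by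
    rcases exists_norm_fourierCoeff_eq m h.p_pos with h0 | ⟨j, hj, hjB⟩
    · rw [h0, mul_zero]
      have : 0 ≤ sSup (periodogram n k y '' Set.Icc (0 : ℝ) (1 / 2)) := by
        apply Real.sSup_nonneg
        rintro _ ⟨v, _, rfl⟩
        exact norm_nonneg _
      linarith
    · have h1 := le_csSup hbdd ⟨_, h.div_mem_Icc hj, rfl⟩
      have h2 := h.le_signal_leakageTwo hj
      have h3 := (abs_lt.mp (h.abs_periodogram_sub_lt (j / p))).1
      rw [hjB] at h2
      linarith
  have hpos : 0 < 1 - Real.pi * leakageTwo n g := by linarith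
  unfold threshold
  have h4 : maxMagnitude m p ≤ (noiseLevel n σ H +
      sSup (periodogram n k y '' Set.Icc (0 : ℝ) (1 / 2))) / (1 - Real.pi * leakageTwo n g) := by
    rw [le_div_iff₀ hpos]
    linarith
  have h5 := mul_le_mul_of_nonneg_left h4 hu1
  have h6 : Real.pi * leakageOne n g * ((noiseLevel n σ H +
      sSup (periodogram n k y '' Set.Icc (0 : ℝ) (1 / 2))) / (1 - Real.pi * leakageTwo n g)) =
      Real.pi * leakageOne n g / (1 - Real.pi * leakageTwo n g) * (noiseLevel n σ H +
        sSup (periodogram n k y '' Set.Icc (0 : ℝ) (1 / 2))) := by ring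
  linarith

theorem threshold_le (h : GoodArm n g k p σ H m y) :
    threshold n g σ H (periodogram n k y) ≤ noiseLevel n σ H +
      Real.pi * leakageOne n g / (1 - Real.pi * leakageTwo n g) * (2 * noiseLevel n σ H +
        maxMagnitude m p * max (Real.pi * leakageOne n g) (Real.pi * leakageTwo n g + 1)) := by
  have hu2 := h.leakageTwo_bounds
  have hu1 := h.leakageOne_nonneg
  have he := h.noiseLevel_pos
  have hsup : sSup (periodogram n k y '' Set.Icc (0 : ℝ) (1 / 2)) ≤
      3 / 4 * noiseLevel n σ H + maxMagnitude m p *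
        max (Real.pi * leakageOne n g) (Real.pi * leakageTwo n g + 1) := by
    refine csSup_le ⟨_, 0, ⟨le_rfl, by norm_num⟩, rfl⟩ ?_
    rintro _ ⟨v, hv, rfl⟩
    exact h.periodogram_le hv
  have hq : 0 ≤ Real.pi * leakageOne n g / (1 - Real.pi * leakageTwo n g) :=
    div_nonneg hu1 (by linarith)
  exact add_le_add le_rfl (mul_le_mul_of_nonneg_left (by linarith) hq)

theorem le_norm_fourierCoeff (h : GoodArm n g k p σ H m y) {j : ℕ} (hj : j < p)
    (hj0 : fourierCoeff m p j ≠ 0) :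
    (2 * Real.pi * leakageOne n g / (1 - Real.pi * leakageTwo n g) + 2) * noiseLevel n σ H +
      max (8 * Real.pi / 3 * leakageTwo n g)
        (Real.pi * leakageOne n g / (1 - Real.pi * leakageTwo n g) *
            max (Real.pi * leakageOne n g) (Real.pi * leakageTwo n g + 1) +
          Real.pi * leakageTwo n g) * maxMagnitude m p ≤ ‖fourierCoeff m p j‖ := by
  have h1 := h.magnitude
  unfold MagnitudeCondition minMagnitude at h1
  have h2 := h1.trans (sInf_le ⟨‖fourierCoeff m p j‖, ⟨norm_pos_iff.mpr hj0, j, hj, rfl⟩, rfl⟩)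
  exact EReal.coe_le_coe_iff.mp h2

theorem div_mem_initialDomain (h : GoodArm n g k p σ H m y) {j : ℕ} (hj1 : 1 ≤ j)
    (hj : 2 * j ≤ p) (hj0 : fourierCoeff m p j ≠ 0) :
    (j : ℝ) / p ∈ initialDomain n g σ H (periodogram n k y) := by
  have hp := h.p_pos
  have hp' : (0 : ℝ) < p := by exact_mod_cast hp
  have hn' : (0 : ℝ) < n := by exact_mod_cast h.n_pos
  have hB := maxMagnitude_nonneg m p
  have he := h.noiseLevel_pos
  refine ⟨?_, (h.div_mem_Icc hj).2, ?_⟩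
  · have h1 : (2 * g * p : ℝ) < n := by exact_mod_cast h.lt
    have h2 : (1 : ℝ) ≤ j := by exact_mod_cast hj1
    rw [div_le_div_iff₀ hn' hp']
    have : (0 : ℝ) ≤ g * p := by positivity
    nlinarith
  · have h1 := h.le_norm_fourierCoeff (by omega) hj0
    have h2 := h.threshold_le
    have h3 := h.le_signal_leakageTwo hj
    have h4 := (abs_lt.mp (h.abs_periodogram_sub_lt (j / p))).1
    have h5 := mul_le_mul_of_nonneg_right (le_max_right (8 * Real.pi / 3 * leakageTwo n g)
        (Real.pi * leakageOne n g / (1 - Real.pi * leakageTwo n g) *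
            max (Real.pi * leakageOne n g) (Real.pi * leakageTwo n g + 1) +
          Real.pi * leakageTwo n g)) hB
    have h6 : 2 * Real.pi * leakageOne n g / (1 - Real.pi * leakageTwo n g) =
      2 * (Real.pi * leakageOne n g / (1 - Real.pi * leakageTwo n g)) := by ring
    rw [h6] at h1
    set q := Real.pi * leakageOne n g / (1 - Real.pi * leakageTwo n g)
    set M := max (Real.pi * leakageOne n g) (Real.pi * leakageTwo n g + 1)
    -- Noise budget: the magnitude condition supplies `2 + 2q` units of `ε̄`, the threshold uses `1
    -- + 2q` and the noise `3/4`; the rest gives strictness.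
    nlinarith

theorem exists_near_of_mem_initialDomain (h : GoodArm n g k p σ H m y) {v : ℝ}
    (hv : v ∈ initialDomain n g σ H (periodogram n k y)) :
    ∃ j : ℕ, 1 ≤ j ∧ 2 * j ≤ p ∧ fourierCoeff m p j ≠ 0 ∧ n * |v - j / p| < g := by
  obtain ⟨hv1, hv2, hv3⟩ := hv
  have hn' : (0 : ℝ) < n := by exact_mod_cast h.n_pos
  have hv0 : 0 ≤ v := le_trans (by positivity) hv1
  obtain ⟨c, hc, hcv⟩ := exists_nearest h.p_pos hv0 hv2
  have h1 : ¬ (fourierCoeff m p c = 0 ∨ g ≤ n * |v - c / p|) := by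
    intro hfar
    have h2 := h.signal_le_of_far hc hcv hfar
    have h3 := h.le_threshold
    have h4 := (abs_lt.mp (h.abs_periodogram_sub_lt v)).2
    have := h.noiseLevel_pos
    linarith
  push Not at h1
  refine ⟨c, ?_, hc, h1.1, h1.2⟩
  -- The constant frequency is excluded because the domain starts at `g / n`.
  by_contra h0
  have h0 : c = 0 := by omega
  have h5 := h1.2
  rw [h0, Nat.cast_zero, zero_div, sub_zero, abs_of_nonneg hv0] at h5
  rw [div_le_iff₀ hn'] at hv1
  linarith

/-- A frequency near a present frequency at which the periodogram is at least as large is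
within `2 / n` of it. -/
theorem close_of_periodogram_le (h : GoodArm n g k p σ H m y) {j : ℕ} (hj1 : 1 ≤ j)
    (hj : 2 * j ≤ p) (hj0 : fourierCoeff m p j ≠ 0) {w : ℝ} (hw : n * |w - j / p| < g)
    (hle : periodogram n k y (j / p) ≤ periodogram n k y w) : n * |w - j / p| < 2 := by
  by_contra hcon
  push Not at hcon
  have hp : 2 ≤ p := by omega
  have hg5 := h.five_le hp
  have hg' : (5 : ℝ) ≤ g := by exact_mod_cast hg5
  have hn' : (0 : ℝ) < n := by exact_mod_cast h.n_pos
  have hB := maxMagnitude_nonneg m p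
  have he := h.noiseLevel_pos
  have hu2 := h.leakageTwo_bounds
  have h1 := (abs_lt.mp (h.abs_periodogram_sub_lt (j / p))).1
  have h2 := (abs_lt.mp (h.abs_periodogram_sub_lt w)).2
  have h3 := h.le_signal hj
  have h4 := (abs_le.mp (abs_periodogram_sub_le (by omega : j < p) h.periodic n k w)).2
  have h5 := h.leakage_le (δ := 0) (by simp)
  simp only [abs_zero, mul_zero, zero_div, ne_eq, OfNat.ofNat_ne_zero, not_false_eq_true,
    zero_pow, add_zero] at h5
  have h6 := h.leakage_le hw.le
  have h7 := h.le_norm_fourierCoeff (by omega) hj0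
  have h8 : dirichlet n (w - j / p) ≤ 3 / (8 * (n * |w - j / p|)) := by
    have e : dirichlet n (w - j / p) = dirichlet n |w - j / p| := by
      rcases abs_cases (w - j / p) with ⟨h, _⟩ | ⟨h, _⟩
      · rw [h]
      · rw [h, dirichlet_neg]
    rw [e]
    apply dirichlet_le_three_eighths h.n_pos
    · by_contra hh
      have : |w - j / p| = 0 := le_antisymm (not_lt.mp hh) (abs_nonneg _)
      rw [this] at hcon
      linarith
    -- Since `n > 4 g`, the distance is below `1/4`, where the slope `8/3` is available.
    · have h9 : 2 * g * 2 ≤ 2 * g * p := by gcongr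
      have h10 : (4 * g : ℝ) < n := by
        have := h.lt
        exact_mod_cast (show 4 * g < n by omega)
      by_contra hh
      nlinarith
  set ν := n * |w - j / p| with hν
  set b := ‖fourierCoeff m p j‖ with hb
  set B := maxMagnitude m p with hBdef
  set e := noiseLevel n σ H with hedef
  set l := nearLeakage g (p / 2) with hl
  have hl1 : 1 / (2 * g : ℝ) ≤ l := inv_le_nearLeakage (by omega)
  have hl2 := nearLeakage_add_le_pi_mul_leakageTwo h.g_pos hp h.lt
  -- Only the first entry of the maximum in the magnitude condition is used here, with `π U₂ ≥ l`.
  have hb1 : 2 * e + 8 / 3 * l * B ≤ b := by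
    have a1 : 0 ≤ 2 * Real.pi * leakageOne n g / (1 - Real.pi * leakageTwo n g) := by
      have := h.leakageOne_nonneg
      apply div_nonneg <;> linarith
    have a2 : 8 / 3 * l ≤ max (8 * Real.pi / 3 * leakageTwo n g)
        (Real.pi * leakageOne n g / (1 - Real.pi * leakageTwo n g) *
            max (Real.pi * leakageOne n g) (Real.pi * leakageTwo n g + 1) +
          Real.pi * leakageTwo n g) := by
      refine le_trans ?_ (le_max_left _ _)
      have : (0 : ℝ) < 1 / (8 * (g : ℝ) ^ 2) := by positivity
      linarith
    have a3 := mul_le_mul_of_nonneg_right a2 hB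
    have a4 := mul_nonneg a1 he.le
    linarith
  have hν0 : 0 < ν := by linarith
  have hx : 3 / (8 * ν) = 3 / 8 * (1 / ν) := by field_simp
  have hinv : 1 / ν ≤ 1 / 2 := one_div_le_one_div_of_le two_pos hcon
  have hinv0 : 0 < 1 / ν := by positivity
  -- Comparing the two periodogram values leaves `b (1 - 3 / (8ν))` below `3/2 ε̄` plus `B` times
  -- both leakages. This inequality contradicts the `B` part, while `2 (1 - 3/16) > 3/2` settles the
  -- noise. As `l ≥ 1 / (2g)`, it reduces to `5/12 (ν / g)² ≤ 2/3 - 1/ν`.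
  have hnum : l + (l + 5 / 24 * ((ν / g) ^ 2 / g)) ≤ 8 / 3 * l * (1 - 3 / 8 * (1 / ν)) := by
    have c1 : 5 / 12 * (ν / g) ^ 2 ≤ 2 / 3 - 1 / ν := by
      -- Below 5 the bound `g ≥ 5` is used; above it `ν < g` suffices, as `5/12 ≤ 2/3 - 1/5`.
      rcases le_total ν 5 with h5 | h5
      · have c2 : (ν / g) ^ 2 ≤ (ν / 5) ^ 2 := by gcongr
        have c3 : 5 / 12 * (ν / 5) ^ 2 ≤ 2 / 3 - 1 / ν := by
          rw [show 2 / 3 - 1 / ν = (2 / 3 * ν - 1) / ν by field_simp, le_div_iff₀ hν0]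
          nlinarith [mul_nonneg (sub_nonneg.mpr hcon) (sub_nonneg.mpr h5)]
        linarith
      · have c2 : (ν / g) ^ 2 ≤ 1 := by
          apply pow_le_one₀ (by positivity)
          rw [div_le_one (by linarith)]
          exact hw.le
        have c3 : 1 / ν ≤ 1 / 5 := one_div_le_one_div_of_le (by norm_num) h5
        linarith
    have c4 : 5 / 24 * ((ν / g) ^ 2 / g) = 1 / (2 * g) * (5 / 12 * (ν / g) ^ 2) := by
      field_simp
      norm_num
    have c5 : 0 ≤ 5 / 12 * (ν / g) ^ 2 := by positivity
    have c6 : 1 / (2 * g) * (5 / 12 * (ν / g) ^ 2) ≤ l * (2 / 3 - 1 / ν) :=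
      mul_le_mul hl1 c1 c5 (le_trans (by positivity) hl1)
    rw [c4]
    linarith
  rw [hx] at h8
  have hb0 : 0 ≤ b := norm_nonneg _
  have d1 := mul_le_mul_of_nonneg_left h8 hb0
  have d2 := mul_le_mul_of_nonneg_left h5 hB
  have d3 := mul_le_mul_of_nonneg_left h6 hB
  have d4 := mul_le_mul_of_nonneg_right hb1 (by linarith : 0 ≤ 1 - 3 / 8 * (1 / ν))
  have d5 := mul_le_mul_of_nonneg_left hnum hB
  have d6 := mul_le_mul_of_nonneg_left hinv he.le
  nlinarith

end GoodArm

/-! ### The search loop on an arm with small noise -/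

theorem finite_candidateFrequencies (n g : ℕ) : (candidateFrequencies n g).Finite := by
  obtain ⟨N, hN⟩ := exists_nat_gt ((n : ℝ) / (2 * g))
  refine (((Finset.range N ×ˢ Finset.range N).finite_toSet).image
    fun a : ℕ × ℕ => (a.1 : ℚ) / a.2).subset ?_
  rintro q ⟨j₁, j₂, _, h12, h2, rfl⟩
  have : j₂ < N := by exact_mod_cast h2.trans hN
  exact ⟨(j₁, j₂), by simp; omega, rfl⟩

namespace GoodArm

variable {n g k p : ℕ} {σ H : ℝ} {m y : ℕ → ℝ}

theorem div_mem_candidateFrequencies (h : GoodArm n g k p σ H m y) {j : ℕ} (hj1 : 1 ≤ j)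
    (hj : 2 * j ≤ p) : (j : ℚ) / p ∈ candidateFrequencies n g := by
  have hg' : (0 : ℝ) < g := by exact_mod_cast h.g_pos
  have h1 : (2 * g * p : ℝ) < n := by exact_mod_cast h.lt
  refine ⟨j, p, hj1, by omega, ?_, rfl⟩
  rw [lt_div_iff₀ (by positivity)]
  linarith

/-- Distinct fractions with denominators `j₂` and `p` differ by at least `1 / (j₂ p)`. Both
denominators are below `n / (2g)`, so `4 j₂ p < n² / g² ≤ n`. -/
theorem candidate_eq_of_close (h : GoodArm n g k p σ H m y) {j : ℕ} {q : ℚ}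
    (hq : q ∈ candidateFrequencies n g) (hclose : n * |(q : ℝ) - (j : ℝ) / p| < 4) :
    q = (j : ℚ) / p := by
  obtain ⟨j₁, j₂, hj₁, h12, h2, rfl⟩ := hq
  have hg' : (0 : ℝ) < g := by exact_mod_cast h.g_pos
  have hp' : (0 : ℝ) < p := by exact_mod_cast h.p_pos
  have hn' : (0 : ℝ) < n := by exact_mod_cast h.n_pos
  have hj₂ : (0 : ℝ) < j₂ := by exact_mod_cast (by omega : 0 < j₂)
  rw [lt_div_iff₀ (by positivity)] at h2
  have h1 : (2 * g * p : ℝ) < n := by exact_mod_cast h.lt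
  have hsq : (n : ℝ) ≤ g ^ 2 := by exact_mod_cast h.le_sq
  have hprod : (j₂ * (2 * g)) * (2 * g * p) < (n : ℝ) * n :=
    mul_lt_mul'' h2 h1 (by positivity) (by positivity)
  have h4 : 4 * (j₂ * p) < (n : ℝ) := by
    have : (4 * (j₂ * p)) * (n : ℝ) ≤ (4 * (j₂ * p)) * g ^ 2 := by gcongr
    by_contra hh
    push Not at hh
    have := mul_le_mul_of_nonneg_right hh hn'.le
    linarith
  by_contra hne
  have hcross : (j₁ : ℤ) * p - j * j₂ ≠ 0 := by
    intro h0
    apply hne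
    have hpQ : (p : ℚ) ≠ 0 := by exact_mod_cast h.p_pos.ne'
    have hjQ : (j₂ : ℚ) ≠ 0 := by exact_mod_cast (by omega : j₂ ≠ 0)
    rw [div_eq_div_iff hjQ hpQ]
    exact_mod_cast sub_eq_zero.mp h0
  have hone : (1 : ℝ) ≤ |(j₁ : ℝ) * p - j * j₂| := by
    exact_mod_cast Int.one_le_abs hcross
  have he : (((j₁ : ℚ) / j₂ : ℚ) : ℝ) - (j : ℝ) / p = (j₁ * p - j * j₂) / (j₂ * p) := by
    push_cast
    field_simp
  rw [he, abs_div, abs_of_pos (by positivity : (0 : ℝ) < j₂ * p), mul_div_assoc',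
    div_lt_iff₀ (by positivity)] at hclose
  nlinarith

theorem lcmReciprocals_eq (h : GoodArm n g k p σ H m y) {l : List ℚ}
    (hl : ∀ q, q ∈ l ↔ ∃ j, 1 ≤ j ∧ 2 * j ≤ p ∧ fourierCoeff m p j ≠ 0 ∧ q = (j : ℚ) / p) :
    lcmReciprocals l = p := by
  have hp := h.p_pos
  have hpQ : (p : ℚ) ≠ 0 := by exact_mod_cast hp.ne'
  have hpC : (p : ℂ) ≠ 0 := by exact_mod_cast hp.ne'
  refine IsLeast.csInf_eq ⟨⟨hp, ?_⟩, ?_⟩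
  · intro q hq
    obtain ⟨j, hj1, _, _, rfl⟩ := (hl q).mp hq
    have hjQ : (j : ℚ) ≠ 0 := by exact_mod_cast (by omega : j ≠ 0)
    exact ⟨j, by field_simp⟩
  · rintro a ⟨ha, haq⟩
    -- By minimality of `p` it is enough that `a` is a period: `a j / p` is an integer for each
    -- present `j`, those above `p / 2` following by conjugation, so every exponential in the
    -- Fourier representation is unchanged by the shift.
    refine h.period.2 ⟨ha, fun t => ?_⟩
    have hint : ∀ j, 1 ≤ j → 2 * j ≤ p → fourierCoeff m p j ≠ 0 →
        ∃ c : ℤ, (a * j : ℂ) = c * p := by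
      intro j hj1 hj hj0
      obtain ⟨c, hc⟩ := haq _ ((hl _).mpr ⟨j, hj1, hj, hj0, rfl⟩)
      have hjQ : (j : ℚ) ≠ 0 := by exact_mod_cast (by omega : j ≠ 0)
      refine ⟨c, ?_⟩
      rw [inv_div, mul_div_assoc', eq_div_iff hjQ] at hc
      exact_mod_cast hc
    have hint' : ∀ j < p, fourierCoeff m p j ≠ 0 → ∃ c : ℤ, (a * j : ℂ) = c * p := by
      intro j hj hj0
      rcases Nat.eq_zero_or_pos j with rfl | hj1
      · exact ⟨0, by simp⟩
      rcases le_total (2 * j) p with h2 | h2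
      · exact hint j hj1 h2 hj0
      · have hne : fourierCoeff m p (p - j) ≠ 0 := by
          rw [← norm_pos_iff, norm_fourierCoeff_sub m hp hj.le]
          exact norm_pos_iff.mpr hj0
        obtain ⟨c, hc⟩ := hint (p - j) (by omega) (by omega) hne
        refine ⟨a - c, ?_⟩
        push_cast [hj.le] at hc ⊢
        linear_combination -hc
    have hC : (m (t + a) : ℂ) = m t := by
      rw [fourierCoeff_representation m p hp h.periodic,
        fourierCoeff_representation m p hp h.periodic]
      refine Finset.sum_congr rfl fun j hj => ?_
      rcases eq_or_ne (fourierCoeff m p j) 0 with h0 | h0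
      · simp [h0]
      · obtain ⟨c, hc⟩ := hint' j (Finset.mem_range.mp hj) h0
        congr 1
        rw [Complex.exp_eq_exp_iff_exists_int]
        refine ⟨c, ?_⟩
        push_cast
        field_simp
        linear_combination hc
    exact_mod_cast hC

/-- The frequency domain that is left when the neighbourhoods of `j / p`, `j ∈ S`, are removed. -/
def remainingDomain (n g p : ℕ) (D : Set ℝ) (S : Finset ℕ) : Set ℝ :=
  D \ {v | ∃ j ∈ S, v ∈ Set.Ioo ((j : ℝ) / p - (g : ℝ) / n) ((j : ℝ) / p + (g : ℝ) / n)}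

theorem exists_isMaxOn (S : Finset ℕ)
    (hne : (remainingDomain n g p (initialDomain n g σ H (periodogram n k y)) S).Nonempty) :
    ∃ w ∈ remainingDomain n g p (initialDomain n g σ H (periodogram n k y)) S,
      IsMaxOn (periodogram n k y)
        (remainingDomain n g p (initialDomain n g σ H (periodogram n k y)) S) w := by
  set U : Set ℝ :=
    {v | ∃ j ∈ S, v ∈ Set.Ioo ((j : ℝ) / p - (g : ℝ) / n) ((j : ℝ) / p + (g : ℝ) / n)} with hU
  have hUo : IsOpen U := by
    have : U = ⋃ j ∈ S, Set.Ioo ((j : ℝ) / p - (g : ℝ) / n) ((j : ℝ) / p + (g : ℝ) / n) := by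
      ext v
      simp only [hU, Set.mem_ofPred_eq, Set.mem_iUnion, exists_prop]
    rw [this]
    exact isOpen_biUnion fun _ _ => isOpen_Ioo
  -- The domain itself need not be closed, its threshold inequality being strict. The maximum is
  -- taken over the compact set without that inequality; the maximiser satisfies it because some
  -- point does.
  have hcomp : IsCompact (Set.Icc ((g : ℝ) / n) (1 / 2) \ U) := isCompact_Icc.diff hUo
  obtain ⟨x, hx, hxU⟩ := hne
  obtain ⟨w, hw, hmax⟩ := hcomp.exists_isMaxOn ⟨x, ⟨hx.1, hx.2.1⟩, hxU⟩
    (continuous_periodogram n k y).continuousOn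
  refine ⟨w, ⟨⟨hw.1.1, hw.1.2, ?_⟩, hw.2⟩, ?_⟩
  · exact hx.2.2.trans_le (hmax ⟨⟨hx.1, hx.2.1⟩, hxU⟩)
  · exact fun v hv => hmax ⟨⟨hv.1.1, hv.1.2.1⟩, hv.2⟩

/-- Distinct frequencies are at least `1 / p > 2 g / n` apart, so removing one neighbourhood never
removes another present frequency. -/
theorem div_mem_remainingDomain (h : GoodArm n g k p σ H m y) {S : Finset ℕ} {j : ℕ}
    (hj1 : 1 ≤ j) (hj : 2 * j ≤ p) (hj0 : fourierCoeff m p j ≠ 0) (hS : j ∉ S) :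
    (j : ℝ) / p ∈ remainingDomain n g p (initialDomain n g σ H (periodogram n k y)) S := by
  refine ⟨h.div_mem_initialDomain hj1 hj hj0, ?_⟩
  rintro ⟨i, hi, hi1, hi2⟩
  have hp' : (0 : ℝ) < p := by exact_mod_cast h.p_pos
  have hn' : (0 : ℝ) < n := by exact_mod_cast h.n_pos
  have h1 : (2 * g * p : ℝ) < n := by exact_mod_cast h.lt
  have hne : (j : ℤ) - i ≠ 0 := by
    intro h0
    apply hS
    rwa [show j = i by omega]
  have hone : (1 : ℝ) ≤ |(j : ℝ) - i| := by exact_mod_cast Int.one_le_abs hne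
  have hlt : |(j : ℝ) / p - i / p| < g / n := abs_lt.mpr ⟨by linarith, by linarith⟩
  rw [← sub_div, abs_div, abs_of_pos hp', div_lt_div_iff₀ hp' hn'] at hlt
  have : (0 : ℝ) ≤ g * p := by positivity
  nlinarith

theorem exists_of_searchStep (h : GoodArm n g k p σ H m y) {S : Finset ℕ} {s s' : SearchState}
    (hdom : s.domain = remainingDomain n g p (initialDomain n g σ H (periodogram n k y)) S)
    (hstep : SearchStep n g (periodogram n k y) s s') :
    ∃ j, 1 ≤ j ∧ 2 * j ≤ p ∧ fourierCoeff m p j ≠ 0 ∧ j ∉ S ∧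
      s'.domain = remainingDomain n g p (initialDomain n g σ H (periodogram n k y)) (insert j S) ∧
      s'.found = ((j : ℚ) / p) :: s.found := by
  obtain ⟨w, hw, hmax, q, hq, hmin, hdom', hfound⟩ := hstep
  have hn' : (0 : ℝ) < n := by exact_mod_cast h.n_pos
  rw [hdom] at hw hmax
  obtain ⟨j, hj1, hj, hj0, hnear⟩ := h.exists_near_of_mem_initialDomain hw.1
  have hjS : j ∉ S := by
    intro hjS
    apply hw.2
    have : |w - j / p| < g / n := by
      rw [lt_div_iff₀ hn']
      linarith
    obtain ⟨a, b⟩ := abs_lt.mp this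
    exact ⟨j, hjS, by linarith, by linarith⟩
  have hclose := h.close_of_periodogram_le hj1 hj hj0 hnear
    (hmax (h.div_mem_remainingDomain hj1 hj hj0 hjS))
  have hqj : q = (j : ℚ) / p := by
    apply h.candidate_eq_of_close hq
    have h1 : |(q : ℝ) - w| ≤ |(((j : ℚ) / p : ℚ) : ℝ) - w| :=
      hmin (h.div_mem_candidateFrequencies hj1 hj)
    push_cast at h1
    rw [abs_sub_comm ((j : ℝ) / p)] at h1
    have h2 := abs_sub_le (q : ℝ) w (j / p)
    have h3 : n * |(q : ℝ) - j / p| ≤ n * (|w - j / p| + |w - j / p|) := by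
      gcongr
      linarith
    linarith
  subst hqj
  refine ⟨j, hj1, hj, hj0, hjS, ?_, hfound⟩
  rw [hdom', hdom]
  ext v
  simp only [remainingDomain, Set.mem_sdiff, Set.mem_ofPred_eq, Finset.mem_insert,
    exists_eq_or_imp, not_or, Rat.cast_div, Rat.cast_natCast]
  tauto

open Classical in
/-- The indices of the present nonzero frequencies in `(0, 1/2]`. -/
def presentIndices (m : ℕ → ℝ) (p : ℕ) : Finset ℕ :=
  (Finset.range (p + 1)).filter fun j => 1 ≤ j ∧ 2 * j ≤ p ∧ fourierCoeff m p j ≠ 0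

theorem mem_presentIndices {j : ℕ} :
    j ∈ presentIndices m p ↔ 1 ≤ j ∧ 2 * j ≤ p ∧ fourierCoeff m p j ≠ 0 := by
  unfold presentIndices
  rw [Finset.mem_filter, Finset.mem_range]
  constructor
  · exact fun h => h.2
  · exact fun h => ⟨by omega, h⟩

/-- Induction on the number of present frequencies not yet found. The invariant is that the domain
is the initial one without the neighbourhoods of those found; it holds for every way of breaking
ties. -/
theorem alwaysReturns (h : GoodArm n g k p σ H m y) (N : ℕ) :
    ∀ (S : Finset ℕ) (s : SearchState), S ⊆ presentIndices m p →
      (presentIndices m p \ S).card = N →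
      s.domain = remainingDomain n g p (initialDomain n g σ H (periodogram n k y)) S →
      (∀ q, q ∈ s.found ↔ ∃ j ∈ S, q = (j : ℚ) / p) →
      AlwaysReturns n g (periodogram n k y) s p := by
  induction N with
  | zero =>
    intro S s hS hcard hdom hfound
    have hSJ : S = presentIndices m p :=
      hS.antisymm (Finset.sdiff_eq_empty_iff_subset.mp (Finset.card_eq_zero.mp hcard))
    have hempty : s.domain = ∅ := by
      rw [hdom, Set.eq_empty_iff_forall_notMem]
      intro w hw
      obtain ⟨j, hj1, hj, hj0, hnear⟩ := h.exists_near_of_mem_initialDomain hw.1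
      have hn' : (0 : ℝ) < n := by exact_mod_cast h.n_pos
      have : |w - j / p| < g / n := by
        rw [lt_div_iff₀ hn']
        linarith
      obtain ⟨a, b⟩ := abs_lt.mp this
      exact hw.2 ⟨j, hSJ ▸ mem_presentIndices.mpr ⟨hj1, hj, hj0⟩, by linarith, by linarith⟩
    have hlcm : lcmReciprocals s.found = p := by
      apply h.lcmReciprocals_eq
      intro q
      rw [hfound, hSJ]
      simp only [mem_presentIndices, and_assoc]
    rw [← hlcm]
    exact AlwaysReturns.halt s hempty
  | succ N ih =>
    intro S s hS hcard hdom hfound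
    have hne : s.domain.Nonempty := by
      obtain ⟨j, hj⟩ := Finset.card_pos.mp (by omega : 0 < (presentIndices m p \ S).card)
      rw [Finset.mem_sdiff, mem_presentIndices] at hj
      rw [hdom]
      exact ⟨_, h.div_mem_remainingDomain hj.1.1 hj.1.2.1 hj.1.2.2 hj.2⟩
    refine AlwaysReturns.step s p hne ?_ ?_
    · rw [hdom] at hne
      obtain ⟨w, hw, hmax⟩ := exists_isMaxOn S hne
      obtain ⟨j, hj1, hj, -, -⟩ := h.exists_near_of_mem_initialDomain hw.1
      obtain ⟨q, hq, hmin⟩ := Set.exists_min_image (candidateFrequencies n g)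
        (fun r : ℚ => |(r : ℝ) - w|) (finite_candidateFrequencies n g)
        ⟨_, h.div_mem_candidateFrequencies hj1 hj⟩
      exact ⟨⟨s.domain \ Set.Ioo ((q : ℝ) - (g : ℝ) / n) ((q : ℝ) + (g : ℝ) / n), q :: s.found⟩,
        w, hdom ▸ hw, hdom ▸ hmax, q, hq, hmin, rfl, rfl⟩
    · intro s' hs'
      obtain ⟨j, hj1, hj, hj0, hjS, hdom', hfound'⟩ := h.exists_of_searchStep hdom hs'
      have hjJ : j ∈ presentIndices m p := mem_presentIndices.mpr ⟨hj1, hj, hj0⟩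
      refine ih (insert j S) s' (Finset.insert_subset hjJ hS) ?_ hdom' ?_
      · rw [Finset.sdiff_insert, Finset.card_erase_of_mem (Finset.mem_sdiff.mpr ⟨hjJ, hjS⟩), hcard]
        rfl
      · intro q
        rw [hfound', List.mem_cons, hfound]
        simp [Finset.mem_insert]

theorem estimatesPeriod (h : GoodArm n g k p σ H m y) : EstimatesPeriod n g σ H k y p := by
  refine h.alwaysReturns _ ∅ _ (Finset.empty_subset _) rfl ?_ ?_
  · simp [remainingDomain]
  · simp

end GoodArm

/-! ### Bounding a polynomial on the unit circle by its values at roots of unity -/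

section RootsOfUnity

variable {N : ℕ} {ω z : ℂ}

theorem conj_eq_inv_of_norm_eq_one (hz : ‖z‖ = 1) : (starRingEnd ℂ) z = z⁻¹ := by
  rw [Complex.inv_def, Complex.normSq_eq_norm_sq, hz]
  simp

theorem norm_primitiveRoot (hω : IsPrimitiveRoot ω N) (hN : 0 < N) : ‖ω‖ = 1 :=
  Complex.norm_eq_one_of_pow_eq_one hω.pow_eq_one hN.ne'

theorem sum_primitiveRoot_pow_mul_conj (hω : IsPrimitiveRoot ω N) {s t : ℕ} (hs : s < N)
    (ht : t < N) :
    ∑ l ∈ Finset.range N, (ω ^ l) ^ s * (starRingEnd ℂ) (ω ^ l) ^ t =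
      if s = t then (N : ℂ) else 0 := by
  have hN : 0 < N := by omega
  have hω0 : ω ≠ 0 := hω.ne_zero hN.ne'
  set x := ω ^ s * (ω ^ t)⁻¹ with hx
  have hterm : ∀ l : ℕ, (ω ^ l) ^ s * (starRingEnd ℂ) (ω ^ l) ^ t = x ^ l := by
    intro l
    rw [map_pow, conj_eq_inv_of_norm_eq_one (norm_primitiveRoot hω hN), hx, mul_pow, inv_pow,
      inv_pow, inv_pow, ← pow_mul, ← pow_mul, ← pow_mul, ← pow_mul, mul_comm l s, mul_comm l t]
  simp_rw [hterm]
  split_ifs with h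
  · have : x = 1 := by rw [hx, h, mul_inv_cancel₀ (pow_ne_zero _ hω0)]
    simp [this]
  · have hx1 : x ≠ 1 := by
      intro h1
      rw [hx, mul_inv_eq_one₀ (pow_ne_zero _ hω0)] at h1
      exact h (hω.pow_inj hs ht h1)
    have hxN : x ^ N = 1 := by
      rw [hx, mul_pow, inv_pow, ← pow_mul, ← pow_mul, mul_comm s, mul_comm t, pow_mul, pow_mul,
        hω.pow_eq_one]
      simp
    rw [geom_sum_eq hx1, hxN]
    simp

theorem sum_primitiveRoot_mul_geom (hω : IsPrimitiveRoot ω N) {s M : ℕ} (hs : s < N) (hM : M ≤ N)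
    (z : ℂ) :
    ∑ l ∈ Finset.range N, (ω ^ l) ^ s *
      ∑ t ∈ Finset.range M, (z * (starRingEnd ℂ) (ω ^ l)) ^ t =
        if s < M then N * z ^ s else 0 := by
  simp_rw [Finset.mul_sum]
  rw [Finset.sum_comm]
  have : ∀ t ∈ Finset.range M, ∑ l ∈ Finset.range N,
      (ω ^ l) ^ s * (z * (starRingEnd ℂ) (ω ^ l)) ^ t = if s = t then N * z ^ s else 0 := by
    intro t ht
    have h1 := sum_primitiveRoot_pow_mul_conj hω hs ((Finset.mem_range.mp ht).trans_le hM)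
    calc _ = z ^ t * ∑ l ∈ Finset.range N, (ω ^ l) ^ s * (starRingEnd ℂ) (ω ^ l) ^ t := by
          rw [Finset.mul_sum]
          refine Finset.sum_congr rfl fun l _ => ?_
          rw [mul_pow]
          ring
      _ = _ := by
          rw [h1]
          split_ifs with h
          · rw [h]; ring
          · ring
  rw [Finset.sum_congr rfl this, Finset.sum_ite_eq]
  simp only [Finset.mem_range]

theorem sum_norm_sq_geom (hω : IsPrimitiveRoot ω N) {M : ℕ} (hM : M ≤ N) (hz : ‖z‖ = 1) :
    ∑ l ∈ Finset.range N, ‖∑ t ∈ Finset.range M, (z * (starRingEnd ℂ) (ω ^ l)) ^ t‖ ^ 2 =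
      N * M := by
  have hC : ∑ l ∈ Finset.range N, ((‖∑ t ∈ Finset.range M,
      (z * (starRingEnd ℂ) (ω ^ l)) ^ t‖ ^ 2 : ℝ) : ℂ) = N * M := by
    have h1 : ∀ l : ℕ, ((‖∑ t ∈ Finset.range M,
        (z * (starRingEnd ℂ) (ω ^ l)) ^ t‖ ^ 2 : ℝ) : ℂ) =
        ∑ s ∈ Finset.range M, (starRingEnd ℂ) z ^ s * ((ω ^ l) ^ s *
          ∑ t ∈ Finset.range M, (z * (starRingEnd ℂ) (ω ^ l)) ^ t) := by
      intro l
      push_cast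
      rw [← Complex.conj_mul', map_sum, Finset.sum_mul]
      refine Finset.sum_congr rfl fun s _ => ?_
      rw [map_pow, map_mul, Complex.conj_conj, mul_pow, mul_assoc]
    simp_rw [h1]
    rw [Finset.sum_comm]
    have h2 : ∀ s ∈ Finset.range M, ∑ l ∈ Finset.range N, (starRingEnd ℂ) z ^ s * ((ω ^ l) ^ s *
          ∑ t ∈ Finset.range M, (z * (starRingEnd ℂ) (ω ^ l)) ^ t) = N := by
      intro s hs
      have hs' := Finset.mem_range.mp hs
      rw [← Finset.mul_sum, sum_primitiveRoot_mul_geom hω (hs'.trans_le hM) hM, if_pos hs',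
        mul_left_comm, ← mul_pow, Complex.conj_mul', hz]
      simp
    rw [Finset.sum_congr rfl h2, Finset.sum_const, Finset.card_range, nsmul_eq_mul, mul_comm]
  exact_mod_cast hC

/-- A polynomial of degree less than `n` is controlled on the unit circle by its values at the
`N`-th roots of unity, `N ≥ n`. -/
theorem norm_sq_polynomial_le (hω : IsPrimitiveRoot ω N) {n : ℕ} (hn : 0 < n) (hnN : n ≤ N)
    (hz : ‖z‖ = 1) (a : ℕ → ℂ) {R : ℝ}
    (h : ∀ l < N, ‖∑ s ∈ Finset.range n, a s * (ω ^ l) ^ s‖ ≤ R) :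
    ((N : ℝ) + 1 - n) * ‖∑ s ∈ Finset.range n, a s * z ^ s‖ ^ 2 ≤ N * R ^ 2 := by
  have hN : 0 < N := by omega
  have hN' : (0 : ℝ) < N := by exact_mod_cast hN
  -- The largest length for which `s < n` and `j < M` imply `s + j < N`, so that no aliasing occurs
  -- at the `N`-th roots of unity.
  set M := N + 1 - n with hM
  have hM0 : 0 < M := by omega
  have hMR : (M : ℝ) = (N : ℝ) + 1 - n := by rw [hM, Nat.cast_sub (by omega)]; push_cast; ring
  set A : ℕ → ℂ := fun l => ∑ t ∈ Finset.range N, (z * (starRingEnd ℂ) (ω ^ l)) ^ t with hA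
  set C : ℕ → ℂ := fun l => ∑ t ∈ Finset.range M, (z * (starRingEnd ℂ) (ω ^ l)) ^ t with hC
  -- The product of `A` and the conjugate of `C` is a reproducing kernel for degrees below `n`: `A`
  -- reproduces each monomial `z ^ (s + j)`, and the conjugate factor cancels `z ^ j`.
  have hid : ∑ l ∈ Finset.range N, (∑ s ∈ Finset.range n, a s * (ω ^ l) ^ s) * (A l *
      (starRingEnd ℂ) (C l)) = N * M * ∑ s ∈ Finset.range n, a s * z ^ s := by
    have h1 : ∀ l : ℕ, (∑ s ∈ Finset.range n, a s * (ω ^ l) ^ s) * (A l *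
        (starRingEnd ℂ) (C l)) = ∑ s ∈ Finset.range n, ∑ j ∈ Finset.range M,
          a s * (starRingEnd ℂ) z ^ j * ((ω ^ l) ^ (s + j) * A l) := by
      intro l
      rw [Finset.sum_mul]
      refine Finset.sum_congr rfl fun s _ => ?_
      rw [hC]
      simp only [map_sum, map_pow, map_mul, Complex.conj_conj, Finset.mul_sum]
      refine Finset.sum_congr rfl fun j _ => ?_
      rw [mul_pow, pow_add]
      ring
    simp_rw [h1]
    rw [Finset.sum_comm, Finset.mul_sum]
    refine Finset.sum_congr rfl fun s hs => ?_
    rw [Finset.sum_comm]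
    have hs' := Finset.mem_range.mp hs
    have h2 : ∀ j ∈ Finset.range M, ∑ l ∈ Finset.range N,
        a s * (starRingEnd ℂ) z ^ j * ((ω ^ l) ^ (s + j) * A l) = N * (a s * z ^ s) := by
      intro j hj
      have hj' := Finset.mem_range.mp hj
      have hsj : s + j < N := by omega
      rw [← Finset.mul_sum, hA, sum_primitiveRoot_mul_geom hω hsj le_rfl, if_pos hsj, pow_add]
      have : (starRingEnd ℂ) z ^ j * z ^ j = 1 := by
        rw [← mul_pow, Complex.conj_mul', hz]
        simp
      linear_combination (N * a s * z ^ s) * this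
    rw [Finset.sum_congr rfl h2, Finset.sum_const, Finset.card_range, nsmul_eq_mul]
    ring
  have hle : N * M * ‖∑ s ∈ Finset.range n, a s * z ^ s‖ ≤
      R * ∑ l ∈ Finset.range N, ‖A l‖ * ‖C l‖ := by
    have h1 := congrArg norm hid
    rw [norm_mul, norm_mul, Complex.norm_natCast, Complex.norm_natCast] at h1
    rw [← h1, Finset.mul_sum]
    refine norm_sum_le_of_le _ fun l hl => ?_
    rw [norm_mul, norm_mul, Complex.norm_conj]
    exact mul_le_mul_of_nonneg_right (h l (Finset.mem_range.mp hl)) (by positivity)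
  -- By Cauchy–Schwarz and Parseval the kernel has `ℓ¹` norm at most `N √(N M)`.
  have hcs := Finset.sum_mul_sq_le_sq_mul_sq (Finset.range N) (fun l => ‖A l‖) fun l => ‖C l‖
  rw [sum_norm_sq_geom hω le_rfl hz, sum_norm_sq_geom hω (by omega : M ≤ N) hz] at hcs
  have hM' : (0 : ℝ) < M := by exact_mod_cast hM0
  have hsq := pow_le_pow_left₀ (by positivity) hle 2
  have h3 : (N * M * ‖∑ s ∈ Finset.range n, a s * z ^ s‖) ^ 2 ≤ R ^ 2 * (N * N * (N * M)) := by
    refine hsq.trans ?_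
    rw [mul_pow]
    gcongr
  rw [← hMR]
  have h4 : (N ^ 2 * M : ℝ) * (M * ‖∑ s ∈ Finset.range n, a s * z ^ s‖ ^ 2) ≤
      (N ^ 2 * M : ℝ) * (N * R ^ 2) := by linarith
  exact le_of_mul_le_mul_left h4 (by positivity)

end RootsOfUnity

/-! ### From a frequency grid to all frequencies -/

theorem norm_transform_eq (n k : ℕ) (f : ℕ → ℝ) (v : ℝ) :
    ‖transform n k f v‖ = 1 / n * ‖∑ i ∈ Finset.range n, (f (n * k + 1 + i) : ℂ) *
      Complex.exp (-(2 * Real.pi * Complex.I * v)) ^ i‖ := by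
  unfold transform
  rw [sum_Icc_epochs, norm_mul, norm_div, norm_one, Complex.norm_natCast]
  have h1 : ∀ i : ℕ, (f (n * k + 1 + i) : ℂ) *
      Complex.exp (-(2 * Real.pi * Complex.I * v * (n * k + 1 + i : ℕ))) =
      Complex.exp (2 * Real.pi * Complex.I * (-v : ℝ) * (n * k + 1 : ℕ)) *
      ((f (n * k + 1 + i) : ℂ) * Complex.exp (-(2 * Real.pi * Complex.I * v)) ^ i) := by
    intro i
    rw [← Complex.exp_nat_mul, mul_left_comm, ← Complex.exp_add]
    congr 2
    push_cast
    ring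
  simp_rw [h1]
  rw [← Finset.mul_sum, norm_mul, norm_exp_two_pi_mul_nat, one_mul]

/-- The transform is controlled by its values on a grid of `L n` frequencies. -/
theorem norm_sq_transform_le_of_grid {n k L : ℕ} (hn : 0 < n) (hL : 1 ≤ L) (f : ℕ → ℝ) {R : ℝ}
    (h : ∀ l < L * n, ‖transform n k f ((l : ℝ) / (L * n : ℕ))‖ ≤ R) (v : ℝ) :
    ((L : ℝ) - 1) * ‖transform n k f v‖ ^ 2 ≤ L * R ^ 2 := by
  have hn' : (0 : ℝ) < n := by exact_mod_cast hn
  have hN : 0 < L * n := Nat.mul_pos hL hn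
  have hω := (Complex.isPrimitiveRoot_exp (L * n) hN.ne').inv
  have hz : ‖Complex.exp (-(2 * Real.pi * Complex.I * v))‖ = 1 := by
    have := norm_exp_two_pi_mul (-v) 1
    rw [← this]
    congr 2
    push_cast
    ring
  have hgrid : ∀ l < L * n, ‖∑ s ∈ Finset.range n, (f (n * k + 1 + s) : ℂ) *
      ((Complex.exp (2 * Real.pi * Complex.I / (L * n : ℕ)))⁻¹ ^ l) ^ s‖ ≤ n * R := by
    intro l hl
    have h1 := h l hl
    rw [norm_transform_eq, one_div_mul_eq_div, div_le_iff₀ hn'] at h1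
    have h2 : (Complex.exp (2 * Real.pi * Complex.I / (L * n : ℕ)))⁻¹ ^ l =
        Complex.exp (-(2 * Real.pi * Complex.I * ((l : ℝ) / (L * n : ℕ) : ℝ))) := by
      rw [← Complex.exp_neg, ← Complex.exp_nat_mul]
      congr 1
      push_cast
      ring
    rw [h2]
    linarith
  have h3 := norm_sq_polynomial_le hω hn (Nat.le_mul_of_pos_left n hL) hz
    (fun s => (f (n * k + 1 + s) : ℂ)) hgrid
  rw [norm_transform_eq]
  set Q := ‖∑ i ∈ Finset.range n, (f (n * k + 1 + i) : ℂ) *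
      Complex.exp (-(2 * Real.pi * Complex.I * v)) ^ i‖
  push_cast at h3
  have h4 : ((L : ℝ) - 1) * n * Q ^ 2 ≤ L * n * (n * R) ^ 2 := by
    refine le_trans ?_ h3
    gcongr
    linarith
  have h5 : n * (((L : ℝ) - 1) * Q ^ 2) ≤ n * (L * (n * R) ^ 2) := by linarith
  have h6 := le_of_mul_le_mul_left h5 hn'
  have e : ((L : ℝ) - 1) * (1 / n * Q) ^ 2 = ((L : ℝ) - 1) * Q ^ 2 / n ^ 2 := by
    field_simp
  rw [e, div_le_iff₀ (by positivity)]
  linarith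

/-! ### Tail bounds for the noise -/

/-- Weights of modulus at most 1 keep the variance proxy, so all directional sums obey one bound
with proxy `n σ²`. -/
theorem hasSubgaussianMGF_const_mul {Ω : Type*} [MeasurableSpace Ω] {P : Measure Ω} {X : Ω → ℝ}
    {c : ℝ≥0} (hX : HasSubgaussianMGF X c P) {a : ℝ} (ha : |a| ≤ 1) :
    HasSubgaussianMGF (fun ω => a * X ω) c P := by
  have h := hX.const_mul a
  refine ⟨h.integrable_exp_mul, fun t => (h.mgf_le t).trans ?_⟩
  rw [Real.exp_le_exp]
  have h1 : a ^ 2 ≤ 1 := (sq_le_one_iff_abs_le_one a).mpr ha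
  have h2 : (0 : ℝ) ≤ c * t ^ 2 := by positivity
  have h3 : a ^ 2 * c * t ^ 2 / 2 ≤ c * t ^ 2 / 2 := by nlinarith
  exact h3

theorem SubGaussianNoise.tail_le {Ω : Type*} [MeasurableSpace Ω] {P : Measure Ω}
    [IsProbabilityMeasure P] {T : ℕ} {σ : ℝ≥0} {ε : ℕ → Ω → ℝ} (hε : SubGaussianNoise P T σ ε)
    {I : Finset ℕ} (hI : I ⊆ Finset.Icc 1 T) {a : ℕ → ℝ} (ha : ∀ s, |a s| ≤ 1) {y : ℝ}
    (hy : 0 ≤ y) :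
    P.real {ω | y ≤ ∑ s ∈ I, a s * ε s ω} ≤ Real.exp (-y ^ 2 / (2 * (I.card * (σ : ℝ) ^ 2))) := by
  have hinj : Function.Injective (fun s : I => (⟨s, hI s.2⟩ : Finset.Icc 1 T)) := by
    intro s t hst
    exact Subtype.ext (congrArg (fun x : Finset.Icc 1 T => (x : ℕ)) hst)
  have hind := (hε.indep.precomp hinj).comp (fun s x => a s * x)
    fun s => measurable_const_mul (a s)
  have h := HasSubgaussianMGF.measure_sum_ge_le_of_iIndepFun hind (c := fun _ => σ ^ 2)
    (s := Finset.univ)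
    (fun s _ => hasSubgaussianMGF_const_mul (hε.subGaussian s (hI s.2)) (ha s)) hy
  have e : ∀ ω, ∑ s ∈ I, a s * ε s ω = ∑ s : I, a s * ε s ω := fun ω =>
    (Finset.sum_coe_sort I fun s => a s * ε s ω).symm
  simp_rw [e]
  refine h.trans (le_of_eq ?_)
  simp

/-- The four weights `± cos`, `± sin` whose sums bound the transform of the noise. -/
def directionWeight (v : ℝ) (d : Fin 4) (s : ℕ) : ℝ :=
  ![Real.cos (2 * Real.pi * v * s), -Real.cos (2 * Real.pi * v * s),
    Real.sin (2 * Real.pi * v * s), -Real.sin (2 * Real.pi * v * s)] d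

theorem abs_directionWeight_le (v : ℝ) (d : Fin 4) (s : ℕ) : |directionWeight v d s| ≤ 1 := by
  unfold directionWeight
  fin_cases d <;> simp [Real.abs_cos_le_one, Real.abs_sin_le_one]

theorem norm_transform_le_of_directions {n k : ℕ} (hn : 0 < n) {f : ℕ → ℝ} {v R : ℝ}
    (h : ∀ d, ∑ s ∈ Finset.Icc (n * k + 1) (n * (k + 1)), directionWeight v d s * f s <
      n * R / √2) : ‖transform n k f v‖ ≤ R := by
  have hn' : (0 : ℝ) < n := by exact_mod_cast hn
  set I := Finset.Icc (n * k + 1) (n * (k + 1))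
  set c := ∑ s ∈ I, Real.cos (2 * Real.pi * v * s) * f s with hc
  set d := ∑ s ∈ I, Real.sin (2 * Real.pi * v * s) * f s with hd
  have h0 := h 0
  have h1 := h 1
  have h2 := h 2
  have h3 := h 3
  simp only [directionWeight, Matrix.cons_val_zero, Matrix.cons_val_one, Matrix.cons_val, neg_mul,
    Finset.sum_neg_distrib] at h0 h1 h2 h3
  rw [← hc] at h0 h1
  rw [← hd] at h2 h3
  have hc2 : c ^ 2 ≤ (n * R / √2) ^ 2 := sq_le_sq' (by linarith) h0.le
  have hd2 : d ^ 2 ≤ (n * R / √2) ^ 2 := sq_le_sq' (by linarith) h2.le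
  -- The strict bounds for both signs of one direction force the level to be positive.
  have hy : 0 < n * R / √2 := by linarith
  have hR : 0 < R := by
    by_contra hh
    push Not at hh
    have : n * R / √2 ≤ 0 :=
      div_nonpos_of_nonpos_of_nonneg (mul_nonpos_of_nonneg_of_nonpos hn'.le hh) (by positivity)
    linarith
  have hy2 : (n * R / √2) ^ 2 = (n * R) ^ 2 / 2 := by
    rw [div_pow, Real.sq_sqrt (by norm_num)]
  have hsum : ∑ s ∈ I, (f s : ℂ) * Complex.exp (-(2 * Real.pi * Complex.I * v * s)) =
      (c : ℂ) + ((-d : ℝ) : ℂ) * Complex.I := by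
    rw [hc, hd]
    push_cast
    rw [← Finset.sum_neg_distrib, Finset.sum_mul, ← Finset.sum_add_distrib]
    refine Finset.sum_congr rfl fun s _ => ?_
    rw [show (-(2 * Real.pi * Complex.I * v * s) : ℂ) = (-(2 * Real.pi * v * s)) * Complex.I by
      ring, Complex.exp_mul_I, Complex.cos_neg, Complex.sin_neg]
    ring
  unfold transform
  rw [hsum, norm_mul, norm_div, norm_one, Complex.norm_natCast, one_div_mul_eq_div,
    div_le_iff₀ hn', Complex.norm_add_mul_I]
  apply Real.sqrt_le_iff.mpr
  constructor
  · positivity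
  · nlinarith

/-- The level that the transform of the noise is compared with on the grid. -/
def gridLevel (n : ℕ) (σ H : ℝ) : ℝ := 5 / 6 * (2 * σ * H * √(Real.log n / n))

theorem gridLevel_pos {n : ℕ} (hn : 2 ≤ n) {σ H : ℝ} (hσ : 0 < σ) (hH : 0 < H) :
    0 < gridLevel n σ H := by
  have hn' : (2 : ℝ) ≤ n := by exact_mod_cast hn
  have h1 : 0 < Real.log n := Real.log_pos (by linarith)
  have h2 : 0 < √(Real.log n / n) := Real.sqrt_pos.mpr (by positivity)
  unfold gridLevel
  positivity

theorem norm_transform_lt_of_grid {n k : ℕ} (hn : 2 ≤ n) {σ H : ℝ} (hσ : 0 < σ) (hH : 0 < H)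
    {f : ℕ → ℝ}
    (h : ∀ l < 50 * n, ‖transform n k f ((l : ℝ) / (50 * n : ℕ))‖ ≤ gridLevel n σ H) (v : ℝ) :
    ‖transform n k f v‖ < 3 / 4 * noiseLevel n σ H := by
  have h1 := norm_sq_transform_le_of_grid (by omega) (by norm_num) f h v
  have hR := gridLevel_pos hn hσ hH
  have hpi := Real.pi_gt_three
  have hpi4 := Real.pi_le_four
  have hX : noiseLevel n σ H = 6 / 5 * gridLevel n σ H / (1 - Real.pi / 24) := by
    unfold noiseLevel gridLevel
    ring
  -- From `π > 3`, which gives `1 - π / 24 < 7/8`.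
  have h2 : 8 / 7 * (6 / 5 * gridLevel n σ H) ≤ noiseLevel n σ H := by
    rw [hX, le_div_iff₀ (by linarith)]
    nlinarith
  -- The grid costs a factor `√(50/49) < 36/35`, and `36/35 = 3/4 · 8/7 · 6/5` is exactly what
  -- remains.
  have h3 : ‖transform n k f v‖ < 36 / 35 * gridLevel n σ H := by
    by_contra hh
    push Not at hh
    have h4 : (36 / 35 * gridLevel n σ H) ^ 2 ≤ ‖transform n k f v‖ ^ 2 := by gcongr
    norm_num at h1
    nlinarith
  linarith

/-- The event that one of the four directional sums of the noise is large at a grid point. -/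
def largeNoiseEvent {Ω : Type*} (ε : ℕ → Ω → ℝ) (n k : ℕ) (R v : ℝ) (d : Fin 4) : Set Ω :=
  {ω | n * R / √2 ≤ ∑ s ∈ Finset.Icc (n * k + 1) (n * (k + 1)), directionWeight v d s * ε s ω}

/-- The event that the noise is large for some arm at some grid point. -/
def badEvent {Ω : Type*} (ε : ℕ → Ω → ℝ) (K n : ℕ) (R : ℝ) : Set Ω :=
  ⋃ i ∈ Finset.range K ×ˢ (Finset.range (50 * n) ×ˢ (Finset.univ : Finset (Fin 4))),
    largeNoiseEvent ε n i.1 R ((i.2.1 : ℝ) / (50 * n : ℕ)) i.2.2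

section

variable {Ω : Type*} [MeasurableSpace Ω] {P : Measure Ω} {K T n : ℕ} {σ : ℝ≥0} {ε : ℕ → Ω → ℝ}

theorem epochs_subset (hT : n * K ≤ T) {k : ℕ} (hk : k < K) :
    Finset.Icc (n * k + 1) (n * (k + 1)) ⊆ Finset.Icc 1 T := by
  apply Finset.Icc_subset_Icc (by omega)
  exact (Nat.mul_le_mul_left n hk).trans hT

theorem SubGaussianNoise.measurableSet_badEvent (hε : SubGaussianNoise P T σ ε)
    (hT : n * K ≤ T) (R : ℝ) : MeasurableSet (badEvent ε K n R) := by
  refine Finset.measurableSet_biUnion _ fun i hi => ?_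
  have hk := Finset.mem_range.mp (Finset.mem_product.mp hi).1
  refine measurableSet_le measurable_const (Finset.measurable_sum _ fun s hs => ?_)
  exact (hε.measurable s (epochs_subset hT hk hs)).const_mul _

/-- With `R` the grid level, the sub-Gaussian exponent is `n R² / (4 σ²) = (25/36) H² log n`; the
factor `25/36` is the square of the `5/6` in `gridLevel`. -/
theorem SubGaussianNoise.largeNoiseEvent_le [IsProbabilityMeasure P] (hε : SubGaussianNoise P T σ ε)
    (hσ : 0 < σ) {H : ℝ} (hH : 0 < H) (hn : 2 ≤ n) (hT : n * K ≤ T) {k : ℕ} (hk : k < K) (v : ℝ)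
    (d : Fin 4) :
    P.real (largeNoiseEvent ε n k (gridLevel n σ H) v d) ≤ (n : ℝ) ^ (-(25 / 36 * H ^ 2)) := by
  have hn' : (2 : ℝ) ≤ n := by exact_mod_cast hn
  have hσ' : (0 : ℝ) < σ := by exact_mod_cast hσ
  have hR := gridLevel_pos hn hσ' hH
  have hlog : 0 < Real.log n := Real.log_pos (by linarith)
  refine (hε.tail_le (epochs_subset hT hk) (abs_directionWeight_le v d) (by positivity)).trans ?_
  rw [Real.rpow_def_of_pos (by linarith), Real.exp_le_exp, Nat.card_Icc,
    show n * (k + 1) + 1 - (n * k + 1) = n by rw [mul_add]; omega]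
  apply le_of_eq
  rw [div_pow, Real.sq_sqrt (by norm_num)]
  unfold gridLevel
  rw [mul_pow, mul_pow, mul_pow (2 * (σ : ℝ) * H), Real.sq_sqrt (by positivity)]
  field_simp
  norm_num

theorem SubGaussianNoise.badEvent_le [IsProbabilityMeasure P] (hε : SubGaussianNoise P T σ ε)
    (hσ : 0 < σ) {H : ℝ} (hH : 0 < H) (hn : 2 ≤ n) (hT : n * K ≤ T) :
    P.real (badEvent ε K n (gridLevel n σ H)) ≤ 200 * K / (n : ℝ) ^ (0.694 * H ^ 2 - 1) := by
  have hn' : (2 : ℝ) ≤ n := by exact_mod_cast hn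
  have h1 : P.real (badEvent ε K n (gridLevel n σ H)) ≤
      ∑ i ∈ Finset.range K ×ˢ (Finset.range (50 * n) ×ˢ (Finset.univ : Finset (Fin 4))),
        (n : ℝ) ^ (-(25 / 36 * H ^ 2)) := by
    refine (measureReal_biUnion_finset_le _ _).trans (Finset.sum_le_sum fun i hi => ?_)
    exact hε.largeNoiseEvent_le hσ hH hn hT (Finset.mem_range.mp (Finset.mem_product.mp hi).1) _ _
  refine h1.trans ?_
  rw [Finset.sum_const, Finset.card_product, Finset.card_product, Finset.card_range,
    Finset.card_range, Finset.card_univ, Fintype.card_fin, nsmul_eq_mul]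
  -- The `4 · 50 n` events per arm give the constant `200` and the `-1` in the exponent; `25/36 >
  -- 0.694`.
  have h2 : (n : ℝ) * (n : ℝ) ^ (-(25 / 36 * H ^ 2)) ≤ ((n : ℝ) ^ (0.694 * H ^ 2 - 1))⁻¹ := by
    rw [← Real.rpow_neg (by linarith)]
    nth_rw 1 [← Real.rpow_one (n : ℝ)]
    rw [← Real.rpow_add (by linarith)]
    apply Real.rpow_le_rpow_of_exponent_le (by linarith)
    nlinarith [sq_nonneg H]
  have hK : (0 : ℝ) ≤ 200 * K := by positivity
  have h3 := mul_le_mul_of_nonneg_left h2 hK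
  rw [div_eq_mul_inv]
  refine le_trans (le_of_eq ?_) h3
  push_cast
  ring_nf

end

theorem norm_transform_lt_of_notMem_badEvent {Ω : Type*} {K n : ℕ} {ε : ℕ → Ω → ℝ} {σ H : ℝ}
    (hσ : 0 < σ) (hH : 0 < H) (hn : 2 ≤ n) {ω : Ω} (hω : ω ∉ badEvent ε K n (gridLevel n σ H)) {k : ℕ} (hk : k < K) (v : ℝ) :
    ‖transform n k (fun s => ε s ω) v‖ < 3 / 4 * noiseLevel n σ H := by
  refine norm_transform_lt_of_grid hn hσ hH (fun l hl => ?_) v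
  refine norm_transform_le_of_directions (by omega) fun d => ?_
  by_contra hd
  push Not at hd
  apply hω
  simp only [badEvent, Set.mem_iUnion, exists_prop]
  exact ⟨(k, l, d), by simp [hk, hl], hd⟩

end

end PeriodicBandit

/-! ### The probability bound -/

theorem theorem2 {Ω : Type*} [MeasurableSpace Ω] (P : MeasureTheory.Measure Ω)
    [MeasureTheory.IsProbabilityMeasure P]
    (K T n g : ℕ) (H : ℝ) (hH : 0 < H) (σ : ℝ≥0) (hσ : 0 < σ)
    (μ : Fin K → ℕ → ℝ) (p : Fin K → ℕ)
    (hp : ∀ k, PeriodicBandit.IsMinimalPeriod (μ k) (p k))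
    (ε : ℕ → Ω → ℝ) (hε : PeriodicBandit.SubGaussianNoise P T σ ε)
    (hperiod : PeriodicBandit.PeriodCondition K T n g p)
    (hT : n * K ≤ T)
    (hmag : ∀ k, PeriodicBandit.MagnitudeCondition n g σ H (μ k) (p k)) :
    ∃ E : Set Ω, MeasurableSet E ∧
      E ⊆ PeriodicBandit.correctEvent n g σ H μ ε p ∧
      1 - 48 * K / (n : ℝ) ^ (H ^ 2 - 1) - 200 * K / (n : ℝ) ^ (0.867 * H ^ 2 - 1)
          - 200 * K / (n : ℝ) ^ (0.694 * H ^ 2 - 1) ≤ P.real E := by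
  open PeriodicBandit in
  -- Without arms no period condition forces `n ≥ 2`, but then every outcome is correct and the
  -- bound is 1.
  rcases Nat.eq_zero_or_pos K with rfl | hK
  · exact ⟨Set.univ, MeasurableSet.univ, fun ω _ k => k.elim0, by simp⟩
  have hg : (0 : ℝ) < g := by
    have := hperiod.two_le
    exact_mod_cast (by omega : 0 < g)
  have hlt : ∀ k, 2 * g * p k < n := by
    intro k
    have h := hperiod.period_lt k
    rw [lt_div_iff₀ (by positivity)] at h
    have h2 : ((2 * g * p k : ℕ) : ℝ) < n := by
      push_cast
      linarith
    exact_mod_cast h2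
  have hn : 2 ≤ n := by
    have h1 := hlt ⟨0, hK⟩
    have h2 : 0 < p ⟨0, hK⟩ := (hp ⟨0, hK⟩).1.1
    have h3 := Nat.mul_le_mul (Nat.mul_le_mul_left 2 hperiod.two_le) h2
    omega
  have hsq : n ≤ g ^ 2 := by exact_mod_cast (Real.sqrt_le_iff.mp hperiod.sqrt_le).2
  have hmeas := hε.measurableSet_badEvent hT (gridLevel n σ H)
  refine ⟨(badEvent ε K n (gridLevel n σ H))ᶜ, hmeas.compl, ?_, ?_⟩
  · intro ω hω k
    refine GoodArm.estimatesPeriod ⟨hperiod.two_le, hsq, hp k, hlt k, hmag k, fun v => ?_⟩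
    have h := norm_transform_lt_of_notMem_badEvent hσ hH hn hω k.2 v
    simpa [reward] using h
  · rw [MeasureTheory.probReal_compl_eq_one_sub hmeas]
    have h1 := hε.badEvent_le hσ hH hn hT
    -- The last of the three error terms already covers the bad event; the other two only need to be
    -- nonnegative.
    have h2 : 0 ≤ 48 * K / (n : ℝ) ^ (H ^ 2 - 1) := by positivity
    have h3 : 0 ≤ 200 * K / (n : ℝ) ^ (0.867 * H ^ 2 - 1) := by positivity
    linarith
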